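/- Let $d, T \ge 1$ be integers, $\sigma > 0$, $\Sigma_0 \in \mathbb{R}^{d\times d}$ symmetric positive definite, and let $\mathcal{A} \subset \{a \in \mathbb{R}^d : \|a\|_2 \le r\}$ be an action set on which every linear functional attains its maximum, with a (measurable) selection $a_*(\theta) \in \operatorname{argmax}_{a \in \mathcal{A}} \theta^\top a$. In the linear-Gaussian bandit the unknown coefficient vector has prior $\theta_* \sim N(0, \Sigma_0)$, and at each time $t = 0, 1, 2, \dots$ the player takes an action $A_t \in \mathcal{A}$ and receives the reward $R_{t+1} = \theta_*^\top A_t + W_{t+1}$, where the noise variables $W_{t+1} \sim N(0, \sigma^2)$ are i.i.d. and independent of $\theta_*$ and of the player's randomization. Thompson sampling draws, at each time $t$, a vector $\hat\theta_t$ from the posterior distribution of $\theta_*$ given the history $H_t = (A_0, R_1, \dots, A_{t-1}, R_t)$, conditionally independently of $\theta_*$ given $H_t$, and takes the action $A_t = a_*(\hat\theta_t)$. Its Bayesian regret is $\mathrm{Regret}(T) = \sum_{t=0}^{T-1} \mathbb{E}[\theta_*^\top a_*(\theta_*) - R_{t+1}]$. Define $$C_1(d,T) = \sqrt{1 + \max\Big\{\tfrac{24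 \log T}{d}, \sqrt{\tfrac{24 \log T}{d}}\Big\}}, \qquad C_2(d,T,\sigma,r,\Sigma_0) = C_1(d,T)\,\sqrt{2\log\Big(1 + \frac{r^2 \|\Sigma_0\|_{\mathrm{op}} T}{d\sigma^2}\Big)}.$$ Then the expectations in the regret exist and are finite, and $$\mathrm{Regret}(T) \le d\,\sigma\sqrt{T}\; C_2(d,T,\sigma,r,\Sigma_0) + 3 r \sqrt{d}\; \mathrm{tr}(\Sigma_0^{1/2})\; C_1(d,T) + \sqrt{2 r^2\, \mathrm{tr}(\Sigma_0)}.$$ -/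

import Mathlib

open MeasureTheory ProbabilityTheory
open scoped RealInnerProductSpace MatrixOrder

noncomputable section

namespace LinearGaussianBandit

variable {d : ℕ} {Ω : Type*}

/-- `aopt` selects an optimal action: for every parameter vector `θ`, `aopt θ` belongs to the
action set `𝒜` and maximizes `a ↦ θᵀ a` over `𝒜`. The selection is measurable. -/
structure IsOptimalSelection (𝒜 : Set (EuclideanSpace ℝ (Fin d)))
    (aopt : EuclideanSpace ℝ (Fin d) → EuclideanSpace ℝ (Fin d)) : Prop where
  measurable : Measurable aopt
  mem : ∀ θ, aopt θ ∈ 𝒜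
  isMaxOn : ∀ θ, IsMaxOn (fun a => ⟪θ, a⟫) 𝒜 (aopt θ)

/-- The action `A_t = aopt (θhat_t)` that is optimal for the sampled parameter `θhat_t`. -/
def action (aopt : EuclideanSpace ℝ (Fin d) → EuclideanSpace ℝ (Fin d))
    (θhat : ℕ → Ω → EuclideanSpace ℝ (Fin d)) (t : ℕ) (ω : Ω) : EuclideanSpace ℝ (Fin d) :=
  aopt (θhat t ω)

/-- The reward `R_{t+1} = θᵀ A_t + W_{t+1}` received after the action `A_t`.
Here `W t` stands for the noise variable `W_{t+1}`, and `reward … t` for `R_{t+1}`. -/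
def reward (aopt : EuclideanSpace ℝ (Fin d) → EuclideanSpace ℝ (Fin d))
    (θ : Ω → EuclideanSpace ℝ (Fin d)) (W : ℕ → Ω → ℝ)
    (θhat : ℕ → Ω → EuclideanSpace ℝ (Fin d)) (t : ℕ) (ω : Ω) : ℝ :=
  ⟪θ ω, action aopt θhat t ω⟫ + W t ω

/-- The history `H_t = (A_0, R_1, …, A_{t-1}, R_t)`: its `i`-th entry is `(A_i, R_{i+1})`. -/
def history (aopt : EuclideanSpace ℝ (Fin d) → EuclideanSpace ℝ (Fin d))
    (θ : Ω → EuclideanSpace ℝ (Fin d)) (W : ℕ → Ω → ℝ)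
    (θhat : ℕ → Ω → EuclideanSpace ℝ (Fin d)) (t : ℕ) (ω : Ω) :
    Fin t → EuclideanSpace ℝ (Fin d) × ℝ :=
  fun i => (action aopt θhat i ω, reward aopt θ W θhat i ω)

/-- Thompson sampling in the linear-Gaussian bandit with prior `N(0, Σ₀)` on the coefficients and
noise variance `σ²`, run with the optimal-action map `aopt`, on the probability space `(Ω, P)`.
* `prior`: the unknown coefficient vector `θ` has law `N(0, Σ₀)`.
* `noise_law`, `noise_indep`: `W_{t+1}` has law `N(0, σ²)` and is independent of everything that
  precedes it, namely `(θ, H_t, θhat_t)`. Since `W_1, …, W_t` are functions of `(θ, H_t)`, this says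
  in particular that `θ, W_1, W_2, …` are independent.
* `sampling`: given `(H_t, θ)`, the sample `θhat_t` is drawn from the posterior distribution of `θ`
  given `H_t`, evaluated at the observed history. That is, `θhat_t` has the same conditional law
  given `H_t` as `θ`, and is conditionally independent of `θ` given `H_t`. -/
structure IsThompsonSampling [MeasurableSpace Ω] (P : Measure Ω) [IsProbabilityMeasure P]
    (Sigma0 : Matrix (Fin d) (Fin d) ℝ) (σ : ℝ)
    (aopt : EuclideanSpace ℝ (Fin d) → EuclideanSpace ℝ (Fin d))
    (θ : Ω → EuclideanSpace ℝ (Fin d)) (W : ℕ → Ω → ℝ)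
    (θhat : ℕ → Ω → EuclideanSpace ℝ (Fin d)) : Prop where
  prior : HasLaw θ (multivariateGaussian 0 Sigma0) P
  noise_law : ∀ t, HasLaw (W t) (gaussianReal 0 (σ ^ 2).toNNReal) P
  noise_indep : ∀ t,
    IndepFun (W t) (fun ω => (θ ω, history aopt θ W θhat t ω, θhat t ω)) P
  sampling : ∀ t,
    HasCondDistrib (θhat t) (fun ω => (history aopt θ W θhat t ω, θ ω))
      ((condDistrib θ (history aopt θ W θhat t) P).prodMkRight (EuclideanSpace ℝ (Fin d))) P

/-- The instantaneous regret `θᵀ aopt(θ) - R_{t+1}`. -/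
def instRegret (aopt : EuclideanSpace ℝ (Fin d) → EuclideanSpace ℝ (Fin d))
    (θ : Ω → EuclideanSpace ℝ (Fin d)) (W : ℕ → Ω → ℝ)
    (θhat : ℕ → Ω → EuclideanSpace ℝ (Fin d)) (t : ℕ) (ω : Ω) : ℝ :=
  ⟪θ ω, aopt (θ ω)⟫ - reward aopt θ W θhat t ω

/-- The Bayesian regret `∑_{t=0}^{T-1} E[θᵀ aopt(θ) - R_{t+1}]`. -/
def regret [MeasurableSpace Ω] (P : Measure Ω)
    (aopt : EuclideanSpace ℝ (Fin d) → EuclideanSpace ℝ (Fin d))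
    (θ : Ω → EuclideanSpace ℝ (Fin d)) (W : ℕ → Ω → ℝ)
    (θhat : ℕ → Ω → EuclideanSpace ℝ (Fin d)) (T : ℕ) : ℝ :=
  ∑ t ∈ Finset.range T, ∫ ω, instRegret aopt θ W θhat t ω ∂P

/-- `C₁(d, T) = √(1 + max {24 log T / d, √(24 log T / d)})`. -/
def C₁ (d T : ℕ) : ℝ :=
  √(1 + max (24 * Real.log T / d) √(24 * Real.log T / d))

/-- `C₂(d, T, σ, r, Σ₀) = C₁(d, T) √(2 log (1 + r² ‖Σ₀‖ T / (d σ²)))`, where `‖Σ₀‖` is the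
Euclidean operator norm. -/
def C₂ (d T : ℕ) (σ r : ℝ) (Sigma0 : Matrix (Fin d) (Fin d) ℝ) : ℝ :=
  C₁ d T * √(2 * Real.log
    (1 + r ^ 2 * ‖Matrix.toEuclideanCLM (𝕜 := ℝ) Sigma0‖ * T / (d * σ ^ 2)))

end LinearGaussianBandit

end

/-! Gaussian conjugacy gives θ = m_t + C_t† Z_t, where m_t and C_t depend only on the history H_t,
S_t = C_t† C_t is the posterior covariance, and Z_t is standard Gaussian and independent of H_t. The
recursive `factor`, `center` and `standardized` realize this decomposition explicitly, so the
posterior is never computed as a kernel.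

Posterior sampling makes (H_t, θhat_t) and (H_t, θ) equal in law, so the m_t terms of the optimal
and the played action have equal expectations. Since Z_t is also independent of (H_t, θhat_t), the
error term of the played action has mean zero. The regret of round t is therefore E⟨C_t a*(θ), Z_t⟩.
The optimal action depends on Z_t, so this is bounded by Cauchy–Schwarz: a chi-square tail bound
gives ‖Z_t‖ ≤ √d C₁ outside an event of probability at most T⁻², and that event costs at most r √(tr
Σ₀) / T (`integral_instRegret_le`). Matching once more replaces E‖C_t a*(θ)‖ by E‖C_t A_t‖.

The sum of ‖C_t A_t‖ = √q_t, with q_t = A_tᵀ S_t A_t, is bounded on every path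
(`sum_sqrt_quadForm_posteriorCov_seq_le`). If q_t ≤ 2σ², then q_t is at most 2σ² log(1 + q_t/σ²),
and these logarithms telescope to a log-determinant. If q_t ≥ 2σ², then √q_t is at most 3r times the
decrease of tr √S_t, so all such rounds together cost at most 3r tr √Σ₀. -/

namespace LinearGaussianBandit

/-! ### Covariance updates and the two potentials, log det S and tr √S. -/

section MatrixPotential

open Matrix

variable {n : Type*} [Fintype n] [DecidableEq n]

/-- The posterior covariance after one observation of `⟨θ, a⟩` with noise variance `σ ^ 2`, when
the prior covariance is `S`. -/
noncomputable def posteriorCov (σ : ℝ) (S : Matrix n n ℝ) (a : n → ℝ) : Matrix n n ℝ :=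
  S - (σ ^ 2 + a ⬝ᵥ S *ᵥ a)⁻¹ • vecMulVec (S *ᵥ a) (S *ᵥ a)

omit [DecidableEq n] in
lemma quadForm_nonneg {S : Matrix n n ℝ} (hS : S.PosSemidef) (a : n → ℝ) : 0 ≤ a ⬝ᵥ S *ᵥ a := by
  simpa using hS.dotProduct_mulVec_nonneg a

omit [DecidableEq n] in
lemma vecMul_of_isHermitian {S : Matrix n n ℝ} (hS : S.IsHermitian) (a : n → ℝ) :
    a ᵥ* S = S *ᵥ a := by
  rw [← mulVec_transpose]
  congr 1

omit [DecidableEq n] in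
lemma mulVec_dotProduct_of_isHermitian {S : Matrix n n ℝ} (hS : S.IsHermitian) (a b : n → ℝ) :
    (S *ᵥ a) ⬝ᵥ b = a ⬝ᵥ S *ᵥ b := by
  rw [dotProduct_mulVec, vecMul_of_isHermitian hS]

/-- Sherman–Morrison: observing along `a` adds a rank-one term to the precision. -/
lemma posteriorCov_mul_precision {σ : ℝ} (hσ : 0 < σ) {S : Matrix n n ℝ} (hS : S.PosDef)
    (a : n → ℝ) :
    posteriorCov σ S a * (S⁻¹ + (σ ^ 2)⁻¹ • vecMulVec a a) = 1 := by
  have hn := quadForm_nonneg hS.posSemidef a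
  have hdet : IsUnit S.det := (isUnit_iff_isUnit_det _).1 hS.isUnit
  have h1 : (S *ᵥ a) ᵥ* S⁻¹ = a := by
    rw [← vecMul_of_isHermitian hS.isHermitian, vecMul_vecMul, mul_nonsing_inv _ hdet, vecMul_one]
  have h2 : vecMulVec (S *ᵥ a) (S *ᵥ a) * vecMulVec a a
      = (a ⬝ᵥ S *ᵥ a) • vecMulVec (S *ᵥ a) a := by
    rw [vecMulVec_mul_vecMulVec, mulVec_dotProduct_of_isHermitian hS.isHermitian, vecMulVec_smul]
  have h3 : S * vecMulVec a a = vecMulVec (S *ᵥ a) a := mul_vecMulVec _ _ _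
  rw [posteriorCov, sub_mul, mul_add, mul_add, mul_nonsing_inv _ hdet, Matrix.mul_smul, Matrix.smul_mul,
    Matrix.smul_mul, Matrix.mul_smul, h2, h3, vecMulVec_mul, h1]
  have hs : σ ^ 2 + a ⬝ᵥ S *ᵥ a ≠ 0 := by positivity
  set q := a ⬝ᵥ S *ᵥ a
  have key : (σ ^ 2)⁻¹ - (σ ^ 2 + q)⁻¹ - (σ ^ 2 + q)⁻¹ * ((σ ^ 2)⁻¹ * q) = 0 := by
    field_simp; ring
  have : (σ ^ 2)⁻¹ • vecMulVec (S *ᵥ a) a - (σ ^ 2 + q)⁻¹ • vecMulVec (S *ᵥ a) a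
      - (σ ^ 2 + q)⁻¹ • (σ ^ 2)⁻¹ • q • vecMulVec (S *ᵥ a) a = 0 := by
    rw [smul_smul, smul_smul, ← sub_smul, ← sub_smul, mul_assoc, key, zero_smul]
  refine Eq.trans ?_ (add_zero (1 : Matrix n n ℝ))
  rw [← this]
  abel

lemma posDef_precision {σ : ℝ} {S : Matrix n n ℝ} (hS : S.PosDef) (a : n → ℝ) :
    (S⁻¹ + (σ ^ 2)⁻¹ • vecMulVec a a).PosDef := by
  refine hS.inv.add_posSemidef (PosSemidef.smul ?_ (by positivity))
  simpa using posSemidef_vecMulVec_self_star a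

lemma inv_posteriorCov {σ : ℝ} (hσ : 0 < σ) {S : Matrix n n ℝ} (hS : S.PosDef) (a : n → ℝ) :
    (posteriorCov σ S a)⁻¹ = S⁻¹ + (σ ^ 2)⁻¹ • vecMulVec a a :=
  inv_eq_right_inv (posteriorCov_mul_precision hσ hS a)

lemma posDef_posteriorCov {σ : ℝ} (hσ : 0 < σ) {S : Matrix n n ℝ} (hS : S.PosDef) (a : n → ℝ) :
    (posteriorCov σ S a).PosDef := by
  rw [← inv_eq_left_inv (posteriorCov_mul_precision hσ hS a)]
  exact (posDef_precision hS a).inv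

/-- By the matrix determinant lemma, one update multiplies the determinant by σ² / (σ² + q). -/
lemma log_det_posteriorCov {σ : ℝ} (hσ : 0 < σ) {S : Matrix n n ℝ} (hS : S.PosDef) (a : n → ℝ) :
    Real.log (1 + a ⬝ᵥ S *ᵥ a / σ ^ 2)
      = Real.log S.det - Real.log (posteriorCov σ S a).det := by
  have hn := quadForm_nonneg hS.posSemidef a
  set q := a ⬝ᵥ S *ᵥ a with hq
  have h1 : posteriorCov σ S a
      = S * (1 - replicateCol Unit ((σ ^ 2 + q)⁻¹ • a) * replicateRow Unit (S *ᵥ a)) := by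
    rw [← vecMulVec_eq, mul_sub, mul_one, mul_vecMulVec, mulVec_smul, smul_vecMulVec]
    rfl
  have h2 : (posteriorCov σ S a).det = S.det * (σ ^ 2 / (σ ^ 2 + q)) := by
    rw [h1, det_mul, det_one_sub_mul_comm]
    congr 1
    rw [det_unique]
    rw [Matrix.sub_apply, one_apply_eq, mul_apply]
    simp only [replicateRow_apply, replicateCol_apply]
    have : ∑ x, (S *ᵥ a) x * ((σ ^ 2 + q)⁻¹ • a) x = (σ ^ 2 + q)⁻¹ * q := by
      rw [hq, dotProduct, Finset.mul_sum]
      exact Finset.sum_congr rfl fun i _ => by simp [Pi.smul_apply, smul_eq_mul]; ring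
    rw [this]
    have : σ ^ 2 + q ≠ 0 := by positivity
    field_simp
    ring
  have hd := hS.det_pos
  rw [h2, Real.log_mul hd.ne' (by positivity)]
  have : 1 + q / σ ^ 2 = (σ ^ 2 / (σ ^ 2 + q))⁻¹ := by field_simp
  rw [this, Real.log_inv]
  ring

/-- AM–GM for the eigenvalues, obtained from the tangent line of log at their mean `m`. -/
lemma log_det_le_card_mul_log_trace [Nonempty n] {M : Matrix n n ℝ} (hM : M.PosDef) :
    Real.log M.det ≤ Fintype.card n * Real.log (M.trace / Fintype.card n) := by
  have hc : (0 : ℝ) < Fintype.card n := by exact_mod_cast Fintype.card_pos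
  have ht : 0 < M.trace / Fintype.card n := div_pos hM.trace_pos hc
  set m := M.trace / Fintype.card n with hm
  have hpos := hM.eigenvalues_pos
  rw [hM.isHermitian.det_eq_prod_eigenvalues]
  simp only [RCLike.ofReal_real_eq_id, id]
  rw [Real.log_prod (fun i _ => (hpos i).ne')]
  have hle : ∀ i, Real.log (hM.isHermitian.eigenvalues i)
      ≤ hM.isHermitian.eigenvalues i / m - 1 + Real.log m := by
    intro i
    have := Real.log_le_sub_one_of_pos (div_pos (hpos i) ht)
    rw [Real.log_div (hpos i).ne' ht.ne'] at this
    linarith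
  refine (Finset.sum_le_sum fun i _ => hle i).trans ?_
  have htr := hM.isHermitian.trace_eq_sum_eigenvalues
  simp only [RCLike.ofReal_real_eq_id, id] at htr
  rw [Finset.sum_add_distrib, Finset.sum_sub_distrib, ← Finset.sum_div, ← htr]
  have : M.trace / m = Fintype.card n := by
    rw [hm]; field_simp [hM.trace_pos.ne']
  rw [this]
  simp

/-- Concavity of `X ↦ tr √X`, expressed for the square roots. -/
lemma two_mul_trace_le {S S' : Matrix n n ℝ} (hS : S.PosDef) (hS' : S'.IsHermitian) :
    2 * S'.trace ≤ S.trace + (S⁻¹ * (S' * S')).trace := by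
  have hdet : IsUnit S.det := (isUnit_iff_isUnit_det _).1 hS.isUnit
  -- Expand tr((S' - S) S⁻¹ (S' - S)) ≥ 0.
  have h := (hS.inv.posSemidef.conjTranspose_mul_mul_same (S' - S)).trace_nonneg
  rw [(hS'.sub hS.isHermitian).eq, trace_mul_comm, ← mul_assoc, trace_mul_comm,
    sub_mul, mul_sub, mul_sub] at h
  simp only [mul_sub, trace_sub] at h
  have e1 : (S⁻¹ * (S' * S)).trace = S'.trace := by
    rw [trace_mul_comm, mul_assoc, mul_nonsing_inv _ hdet, mul_one]
  have e2 : (S⁻¹ * (S * S')).trace = S'.trace := by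
    rw [← mul_assoc, nonsing_inv_mul _ hdet, one_mul]
  have e3 : (S⁻¹ * (S * S)).trace = S.trace := by
    rw [← mul_assoc, nonsing_inv_mul _ hdet, one_mul]
  rw [e1, e2, e3] at h
  linarith

omit [DecidableEq n] in
-- Applied below with √S in place of S, where it bounds the first-order decrease of tr √S from below
-- by a multiple of q^(3/2).
lemma pow_three_le_mul_quadForm {S : Matrix n n ℝ} (hS : S.PosSemidef) {r : ℝ} (hr : 0 ≤ r)
    {a : n → ℝ} (ha : a ⬝ᵥ a ≤ r ^ 2) :
    √((S *ᵥ a) ⬝ᵥ (S *ᵥ a)) ^ 3 ≤ r * ((S *ᵥ a) ⬝ᵥ S *ᵥ (S *ᵥ a)) := by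
  set b := S *ᵥ a with hb
  have hbb : 0 ≤ b ⬝ᵥ b := by simpa using dotProduct_star_self_nonneg b
  set β := √(b ⬝ᵥ b) with hβ
  have hβ0 : 0 ≤ β := Real.sqrt_nonneg _
  have hβ2 : b ⬝ᵥ b = β ^ 2 := (Real.sq_sqrt hbb).symm
  have hab : a ⬝ᵥ b ≤ r * β := by
    refine abs_le_of_sq_le_sq' ?_ (by positivity) |>.2
    have h := Finset.sum_mul_sq_le_sq_mul_sq Finset.univ a b
    have e1 : ∑ i, a i ^ 2 = a ⬝ᵥ a := by simp [dotProduct, sq]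
    have e2 : ∑ i, b i ^ 2 = b ⬝ᵥ b := by simp [dotProduct, sq]
    rw [e1, e2] at h
    calc (a ⬝ᵥ b) ^ 2 ≤ (a ⬝ᵥ a) * (b ⬝ᵥ b) := h
      _ ≤ r ^ 2 * β ^ 2 := by rw [hβ2]; gcongr
      _ = (r * β) ^ 2 := by ring
  have hbSb := quadForm_nonneg hS b
  rcases hr.eq_or_lt with rfl | hr
  · have h1 : a ⬝ᵥ b ≤ 0 := by simpa using hab
    have ha0 : a = 0 := by
      have h0 : a ⬝ᵥ a ≤ 0 := by simpa using ha
      have h00 : 0 ≤ a ⬝ᵥ a := by simpa using dotProduct_star_self_nonneg a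
      exact dotProduct_self_eq_zero.1 (le_antisymm h0 h00)
    have : β = 0 := by rw [hβ, hb, ha0]; simp
    rw [this]; simp
  -- For s ≥ 0 the form at b - s a is at most bᵀSb - 2sβ² + s²rβ; the choice s = β / r minimizes
  -- this.
  · have h := quadForm_nonneg hS (b - (β / r) • a)
    have e : (b - (β / r) • a) ⬝ᵥ S *ᵥ (b - (β / r) • a)
        = b ⬝ᵥ S *ᵥ b - 2 * (β / r) * (b ⬝ᵥ b) + (β / r) ^ 2 * (a ⬝ᵥ b) := by
      have : a ⬝ᵥ S *ᵥ b = b ⬝ᵥ b := by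
        rw [← mulVec_dotProduct_of_isHermitian hS.isHermitian]
      rw [mulVec_sub, mulVec_smul, ← hb]
      simp only [sub_dotProduct, dotProduct_sub, smul_dotProduct, dotProduct_smul, smul_eq_mul,
        this]
      ring
    rw [e, hβ2] at h
    have h2 : (β / r) ^ 2 * (a ⬝ᵥ b) ≤ (β / r) ^ 2 * (r * β) := by gcongr
    have h3 : (β / r) ^ 2 * (r * β) = β ^ 3 / r := by field_simp
    have h4 : 2 * (β / r) * β ^ 2 = 2 * (β ^ 3 / r) := by field_simp
    have h5 : β ^ 3 / r ≤ b ⬝ᵥ S *ᵥ b := by linarith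
    rw [div_le_iff₀ hr] at h5
    linarith

/-- The gradient of tr √ at S is S^(-1/2) / 2, so by concavity the rank-one decrease of S lowers tr
√S by at least half of aᵀ S S^(-1/2) S a / (σ² + q), and S S^(-1/2) S = (√S)³. -/
lemma quadForm_sqrt_le_trace_sqrt_sub {σ : ℝ} (hσ : 0 < σ) {S : Matrix n n ℝ} (hS : S.PosDef)
    (a : n → ℝ) :
    (σ ^ 2 + a ⬝ᵥ S *ᵥ a)⁻¹ * ((CFC.sqrt S *ᵥ a) ⬝ᵥ CFC.sqrt S *ᵥ (CFC.sqrt S *ᵥ a))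
      ≤ 2 * ((CFC.sqrt S).trace - (CFC.sqrt (posteriorCov σ S a)).trace) := by
  have hS' := posDef_posteriorCov hσ hS a
  set R := CFC.sqrt S with hR
  set R' := CFC.sqrt (posteriorCov σ S a) with hR'
  have hRR : R * R = S := CFC.sqrt_mul_sqrt_self _ hS.posSemidef.nonneg
  have hRR' : R' * R' = posteriorCov σ S a :=
    CFC.sqrt_mul_sqrt_self _ hS'.posSemidef.nonneg
  have hRpsd : R.PosSemidef := (CFC.sqrt_nonneg S).posSemidef
  have hRpsd' : R'.PosSemidef := (CFC.sqrt_nonneg (posteriorCov σ S a)).posSemidef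
  have hRu : IsUnit R := by
    rw [isUnit_iff_isUnit_det, isUnit_iff_ne_zero]
    intro h0
    have : S.det = 0 := by rw [← hRR, det_mul, h0, zero_mul]
    exact hS.det_pos.ne' this
  have hRpd : R.PosDef := hRpsd.posDef_iff_isUnit.2 hRu
  have hdet : IsUnit R.det := (isUnit_iff_isUnit_det _).1 hRu
  have h1 := two_mul_trace_le hRpd hRpsd'.isHermitian
  have hSa : S *ᵥ a = R *ᵥ (R *ᵥ a) := by rw [mulVec_mulVec, hRR]
  have hRS : R⁻¹ * S = R := by rw [← hRR, ← mul_assoc, nonsing_inv_mul _ hdet, one_mul]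
  have hRv : R⁻¹ *ᵥ (S *ᵥ a) = R *ᵥ a := by
    rw [hSa, mulVec_mulVec, nonsing_inv_mul _ hdet, one_mulVec]
  have h2 : (R⁻¹ * (R' * R')).trace
      = R.trace - (σ ^ 2 + a ⬝ᵥ S *ᵥ a)⁻¹ * ((R *ᵥ a) ⬝ᵥ R *ᵥ (R *ᵥ a)) := by
    rw [hRR', posteriorCov, mul_sub, trace_sub, Matrix.mul_smul, trace_smul, mul_vecMulVec, hRv,
      trace_vecMulVec, smul_eq_mul, hRS, hSa]
  rw [h2] at h1
  linarith

lemma trace_sqrt_posteriorCov_le {σ : ℝ} (hσ : 0 < σ) {S : Matrix n n ℝ} (hS : S.PosDef)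
    (a : n → ℝ) : (CFC.sqrt (posteriorCov σ S a)).trace ≤ (CFC.sqrt S).trace := by
  have h := quadForm_sqrt_le_trace_sqrt_sub hσ hS a
  have h1 := quadForm_nonneg hS.posSemidef a
  have h2 := quadForm_nonneg (CFC.sqrt_nonneg S).posSemidef (CFC.sqrt S *ᵥ a)
  have : 0 ≤ (σ ^ 2 + a ⬝ᵥ S *ᵥ a)⁻¹ *
    ((CFC.sqrt S *ᵥ a) ⬝ᵥ CFC.sqrt S *ᵥ (CFC.sqrt S *ᵥ a)) := by positivity
  linarith

lemma sqrt_quadForm_le_trace_sqrt_sub {σ : ℝ} (hσ : 0 < σ) {S : Matrix n n ℝ} (hS : S.PosDef)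
    {r : ℝ} (hr : 0 ≤ r) {a : n → ℝ} (ha : a ⬝ᵥ a ≤ r ^ 2) (hlarge : 2 * σ ^ 2 ≤ a ⬝ᵥ S *ᵥ a) :
    √(a ⬝ᵥ S *ᵥ a)
      ≤ 3 * r * ((CFC.sqrt S).trace - (CFC.sqrt (posteriorCov σ S a)).trace) := by
  have hRpsd : (CFC.sqrt S).PosSemidef := (CFC.sqrt_nonneg S).posSemidef
  have hvv : (CFC.sqrt S *ᵥ a) ⬝ᵥ (CFC.sqrt S *ᵥ a) = a ⬝ᵥ S *ᵥ a := by
    rw [mulVec_dotProduct_of_isHermitian hRpsd.isHermitian, mulVec_mulVec,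
      CFC.sqrt_mul_sqrt_self _ hS.posSemidef.nonneg]
  have h3 := quadForm_sqrt_le_trace_sqrt_sub hσ hS a
  have hdec := sub_nonneg.2 (trace_sqrt_posteriorCov_le hσ hS a)
  have h4 := pow_three_le_mul_quadForm hRpsd hr ha
  rw [hvv] at h4
  set q := a ⬝ᵥ S *ᵥ a
  set D := (CFC.sqrt S).trace - (CFC.sqrt (posteriorCov σ S a)).trace
  set x := (CFC.sqrt S *ᵥ a) ⬝ᵥ CFC.sqrt S *ᵥ (CFC.sqrt S *ᵥ a)
  have hq0 : 0 < q := lt_of_lt_of_le (by positivity) hlarge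
  have hsq : √q ^ 2 = q := Real.sq_sqrt hq0.le
  have h5 : √q * q ≤ r * x := by
    calc √q * q = √q ^ 3 := by rw [pow_succ, hsq, mul_comm]
      _ ≤ _ := h4
  have h6 : x ≤ 2 * D * (σ ^ 2 + q) := by
    rwa [inv_mul_le_iff₀ (by positivity), mul_comm] at h3
  -- Since σ² ≤ q / 2, the factor 2 (σ² + q) is at most 3q; this is the origin of the constant 3.
  refine le_of_mul_le_mul_right ?_ hq0
  calc √q * q ≤ r * x := h5
    _ ≤ r * (2 * D * (σ ^ 2 + q)) := by gcongr
    _ ≤ r * (2 * D * (q / 2 + q)) := by gcongr; linarith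
    _ = 3 * r * D * q := by ring

section Sequence

variable {σ : ℝ} {S : ℕ → Matrix n n ℝ} {a : ℕ → n → ℝ}

lemma posDef_posteriorCov_seq (hσ : 0 < σ) (hS0 : (S 0).PosDef)
    (hS : ∀ t, S (t + 1) = posteriorCov σ (S t) (a t)) (t : ℕ) : (S t).PosDef := by
  induction t with
  | zero => exact hS0
  | succ t ih => rw [hS]; exact posDef_posteriorCov hσ ih _

lemma inv_posteriorCov_seq (hσ : 0 < σ) (hS0 : (S 0).PosDef)
    (hS : ∀ t, S (t + 1) = posteriorCov σ (S t) (a t)) (T : ℕ) :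
    (S T)⁻¹ = (S 0)⁻¹ + (σ ^ 2)⁻¹ • ∑ t ∈ Finset.range T, vecMulVec (a t) (a t) := by
  induction T with
  | zero => simp
  | succ T ih =>
    rw [hS, inv_posteriorCov hσ (posDef_posteriorCov_seq hσ hS0 hS T), ih, Finset.sum_range_succ,
      smul_add, add_assoc]

lemma sum_log_posteriorCov_seq_le [Nonempty n] (hσ : 0 < σ) (hS0 : (S 0).PosDef)
    (hS : ∀ t, S (t + 1) = posteriorCov σ (S t) (a t)) {B : ℝ}
    (hB : ∀ t, a t ⬝ᵥ S 0 *ᵥ a t ≤ B) (T : ℕ) :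
    ∑ t ∈ Finset.range T, Real.log (1 + a t ⬝ᵥ S t *ᵥ a t / σ ^ 2)
      ≤ Fintype.card n * Real.log (1 + B * T / (Fintype.card n * σ ^ 2)) := by
  have hpd := posDef_posteriorCov_seq hσ hS0 hS
  have hsum : ∑ t ∈ Finset.range T, Real.log (1 + a t ⬝ᵥ S t *ᵥ a t / σ ^ 2)
      = Real.log (S 0).det - Real.log (S T).det := by
    rw [← Finset.sum_range_sub' (fun t => Real.log (S t).det)]
    exact Finset.sum_congr rfl fun t _ => by rw [log_det_posteriorCov hσ (hpd t), ← hS]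
  set R := CFC.sqrt (S 0) with hR
  have hRR : R * R = S 0 := CFC.sqrt_mul_sqrt_self _ hS0.posSemidef.nonneg
  have hRh : Rᴴ = R := (CFC.sqrt_nonneg (S 0)).posSemidef.isHermitian.eq
  -- M is a symmetric form of S₀ S_T⁻¹: same determinant and trace, and positive definite, so AM–GM
  -- applies to it.
  set M := R * (S T)⁻¹ * R with hM
  have hMdet : M.det = (S 0).det * (S T).det⁻¹ := by
    rw [hM, det_mul, det_mul, ← hRR, det_mul, det_nonsing_inv, Ring.inverse_eq_inv']
    ring
  have hMpsd : M.PosSemidef := by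
    have := (hpd T).inv.posSemidef.mul_mul_conjTranspose_same R
    rwa [hRh] at this
  have hMpd : M.PosDef := by
    rw [hMpsd.posDef_iff_det_ne_zero, hMdet]
    exact mul_ne_zero hS0.det_pos.ne' (inv_ne_zero (hpd T).det_pos.ne')
  have hMlog : Real.log M.det = Real.log (S 0).det - Real.log (S T).det := by
    rw [hMdet, Real.log_mul hS0.det_pos.ne' (inv_ne_zero (hpd T).det_pos.ne'), Real.log_inv]
    ring
  have hc : (0 : ℝ) < Fintype.card n := by exact_mod_cast Fintype.card_pos
  have hMtr : M.trace ≤ Fintype.card n + (σ ^ 2)⁻¹ * (B * T) := by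
    have h1 : M.trace = (S 0 * (S T)⁻¹).trace := by
      rw [hM, trace_mul_comm, ← mul_assoc, hRR]
    have hdet : IsUnit (S 0).det := (isUnit_iff_isUnit_det _).1 hS0.isUnit
    have h2 : ∀ t, (S 0 * vecMulVec (a t) (a t)).trace = a t ⬝ᵥ S 0 *ᵥ a t := fun t => by
      rw [mul_vecMulVec, trace_vecMulVec, dotProduct_comm]
    rw [h1, inv_posteriorCov_seq hσ hS0 hS, mul_add, trace_add, mul_nonsing_inv _ hdet, trace_one,
      Matrix.mul_smul, trace_smul, Finset.mul_sum, trace_sum, smul_eq_mul]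
    gcongr
    simp only [h2]
    refine (Finset.sum_le_sum fun t _ => hB t).trans ?_
    simp [mul_comm]
  rw [hsum, ← hMlog]
  refine (log_det_le_card_mul_log_trace hMpd).trans ?_
  gcongr
  · exact div_pos hMpd.trace_pos hc
  · rw [div_le_iff₀ hc]
    refine hMtr.trans (le_of_eq ?_)
    field_simp

/-- On [0, 2] the concave log(1 + x) lies above its chord, whose slope (log 3) / 2 is at least 1/2.
-/
lemma le_two_mul_log_one_add {x : ℝ} (h0 : 0 ≤ x) (h2 : x ≤ 2) : x ≤ 2 * Real.log (1 + x) := by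
  have hlog3 : 1 ≤ Real.log 3 := by
    rw [Real.le_log_iff_exp_le (by norm_num)]
    exact Real.exp_one_lt_d9.le.trans (by norm_num)
  have hconc := strictConcaveOn_log_Ioi.concaveOn.2 (Set.mem_Ioi.2 one_pos)
    (Set.mem_Ioi.2 (zero_lt_three (α := ℝ))) (sub_nonneg.2 (show x / 2 ≤ 1 by linarith))
    (by linarith : 0 ≤ x / 2) (by ring)
  simp only [smul_eq_mul, Real.log_one, mul_zero, zero_add] at hconc
  have e : (1 - x / 2) * 1 + x / 2 * 3 = 1 + x := by ring
  rw [e] at hconc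
  nlinarith

/-- The elliptical potential bound, with the rounds of large information gain charged to the
decrease of `tr √S`. -/
lemma sum_sqrt_quadForm_posteriorCov_seq_le [Nonempty n] (hσ : 0 < σ) (hS0 : (S 0).PosDef)
    (hS : ∀ t, S (t + 1) = posteriorCov σ (S t) (a t)) {r : ℝ} (hr : 0 ≤ r)
    (ha : ∀ t, a t ⬝ᵥ a t ≤ r ^ 2) {B : ℝ} (hB : ∀ t, a t ⬝ᵥ S 0 *ᵥ a t ≤ B) (T : ℕ) :
    ∑ t ∈ Finset.range T, √(a t ⬝ᵥ S t *ᵥ a t)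
      ≤ σ * √T * √(Fintype.card n *
          (2 * Real.log (1 + B * T / (Fintype.card n * σ ^ 2))))
        + 3 * r * (CFC.sqrt (S 0)).trace := by
  have hpd := posDef_posteriorCov_seq hσ hS0 hS
  set q : ℕ → ℝ := fun t => a t ⬝ᵥ S t *ᵥ a t with hq
  have hq0 : ∀ t, 0 ≤ q t := fun t => quadForm_nonneg (hpd t).posSemidef _
  set L : ℕ → ℝ := fun t => Real.log (1 + q t / σ ^ 2) with hL
  have hL0 : ∀ t, 0 ≤ L t := fun t =>
    Real.log_nonneg (le_add_of_nonneg_right (div_nonneg (hq0 t) (by positivity)))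
  set τ : ℕ → ℝ := fun t => (CFC.sqrt (S t)).trace with hτ
  have hτdec : ∀ t, 0 ≤ τ t - τ (t + 1) := fun t => by
    have := trace_sqrt_posteriorCov_le hσ (hpd t) (a t)
    rw [← hS] at this
    exact sub_nonneg.2 this
  -- Each case needs only one of the two summands; the other is nonnegative.
  have hterm : ∀ t, √(q t) ≤ σ * √(2 * L t) + 3 * r * (τ t - τ (t + 1)) := by
    intro t
    rcases le_total (q t) (2 * σ ^ 2) with h | h
    · have h1 : q t / σ ^ 2 ≤ 2 * L t :=
        le_two_mul_log_one_add (div_nonneg (hq0 t) (by positivity))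
          ((div_le_iff₀ (by positivity)).2 h)
      have h2 : √(q t) ≤ σ * √(2 * L t) := by
        rw [Real.sqrt_le_left (by positivity), mul_pow, Real.sq_sqrt (by linarith [hL0 t])]
        rw [div_le_iff₀ (by positivity)] at h1
        linarith
      have := mul_nonneg (mul_nonneg (by norm_num : (0 : ℝ) ≤ 3) hr) (hτdec t)
      linarith
    · have h1 := sqrt_quadForm_le_trace_sqrt_sub hσ (hpd t) hr (ha t) h
      rw [← hS] at h1
      have : 0 ≤ σ * √(2 * L t) := by positivity
      exact h1.trans (le_add_of_nonneg_left this)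
  refine (Finset.sum_le_sum fun t _ => hterm t).trans ?_
  rw [Finset.sum_add_distrib, ← Finset.mul_sum, ← Finset.mul_sum, Finset.sum_range_sub']
  have hτT : 0 ≤ τ T := (CFC.sqrt_nonneg (S T)).posSemidef.trace_nonneg
  have hcs : ∑ t ∈ Finset.range T, √(2 * L t)
      ≤ √T * √(Fintype.card n * (2 * Real.log (1 + B * T / (Fintype.card n * σ ^ 2)))) := by
    have h1 := Real.sum_sqrt_mul_sqrt_le (Finset.range T) (f := fun _ => (1 : ℝ))
      (g := fun t => 2 * L t) (fun _ => zero_le_one) (fun t => by linarith [hL0 t])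
    simp only [Real.sqrt_one, one_mul, Finset.sum_const, Finset.card_range, nsmul_eq_mul,
      mul_one] at h1
    refine h1.trans ?_
    gcongr
    rw [← Finset.mul_sum]
    have := sum_log_posteriorCov_seq_le hσ hS0 hS hB T
    simp only [hL, hq]
    linarith
  have h3 : 3 * r * (τ 0 - τ T) ≤ 3 * r * τ 0 := by gcongr; linarith
  calc _ ≤ σ * (√T * √(Fintype.card n * (2 * Real.log (1 + B * T / (Fintype.card n * σ ^ 2)))))
        + 3 * r * τ 0 := by gcongr
    _ = _ := by ring

end Sequence

end MatrixPotential

/-! ### One Gaussian observation in standardized coordinates. -/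

section GaussianUpdate

variable {E : Type*} [NormedAddCommGroup E] [InnerProductSpace ℝ E]

/-- The standard deviation of `⟨v, z⟩ + w` for `z` standard Gaussian and `w` of variance `σ ^ 2`. -/
noncomputable def predSD (σ : ℝ) (v : E) : ℝ := √(σ ^ 2 + ‖v‖ ^ 2)

/-- The number `c` for which `1 - c v vᵀ` is the square root of `1 - v vᵀ / (σ ^ 2 + ‖v‖ ^ 2)`. -/
noncomputable def shrink (σ : ℝ) (v : E) : ℝ := (predSD σ v * (predSD σ v + σ))⁻¹

/-- The standardized posterior residual of `z` after the observation of `y = ⟨v, z⟩ + w`. -/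
noncomputable def residual (σ : ℝ) (v : E) (y : ℝ) (z : E) : E :=
  z - (shrink σ v * ⟪v, z⟫ + (y - ⟪v, z⟫) / (predSD σ v * σ)) • v

omit [InnerProductSpace ℝ E] in
lemma predSD_pos {σ : ℝ} (hσ : 0 < σ) (v : E) : 0 < predSD σ v :=
  Real.sqrt_pos.2 (by positivity)

omit [InnerProductSpace ℝ E] in
lemma predSD_sq (σ : ℝ) (v : E) : predSD σ v ^ 2 = σ ^ 2 + ‖v‖ ^ 2 :=
  Real.sq_sqrt (by positivity)

omit [InnerProductSpace ℝ E] in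
lemma two_mul_shrink_sub {σ : ℝ} (hσ : 0 < σ) (v : E) :
    2 * shrink σ v - shrink σ v ^ 2 * ‖v‖ ^ 2 = (σ ^ 2 + ‖v‖ ^ 2)⁻¹ := by
  have hs := predSD_pos hσ v
  have hn : ‖v‖ ^ 2 = predSD σ v ^ 2 - σ ^ 2 := by rw [predSD_sq]; ring
  rw [← predSD_sq, shrink, hn]
  field_simp
  ring

/-- Inverts `residual`: z is its posterior mean given y plus the square root of its posterior
covariance applied to the residual. -/
lemma residual_add_shrink {σ : ℝ} (hσ : 0 < σ) (v : E) (y : ℝ) (z : E) :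
    z = (y / (σ ^ 2 + ‖v‖ ^ 2)) • v
      + (residual σ v y z - (shrink σ v * ⟪v, residual σ v y z⟫) • v) := by
  have hs := predSD_pos hσ v
  have hn : ‖v‖ ^ 2 = predSD σ v ^ 2 - σ ^ 2 := by rw [predSD_sq]; ring
  rw [← predSD_sq]
  have hin : ⟪v, residual σ v y z⟫ = ⟪v, z⟫
      - (shrink σ v * ⟪v, z⟫ + (y - ⟪v, z⟫) / (predSD σ v * σ)) * ‖v‖ ^ 2 := by
    rw [residual, inner_sub_right, inner_smul_right, real_inner_self_eq_norm_sq]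
  rw [hin, residual]
  set p := ⟪v, z⟫
  set α := shrink σ v * p + (y - p) / (predSD σ v * σ) with hα
  have key : y / predSD σ v ^ 2 - α - shrink σ v * (p - α * ‖v‖ ^ 2) = 0 := by
    rw [hα, hn, shrink]
    field_simp
    ring
  have : (y / predSD σ v ^ 2) • v + (z - α • v - (shrink σ v * (p - α * ‖v‖ ^ 2)) • v)
      = z + (y / predSD σ v ^ 2 - α - shrink σ v * (p - α * ‖v‖ ^ 2)) • v := by
    module
  rw [this, key, zero_smul, add_zero]

variable [FiniteDimensional ℝ E] [MeasurableSpace E] [BorelSpace E]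

lemma charFunDual_gaussianReal_zero (s : NNReal) (L : StrongDual ℝ ℝ) :
    charFunDual (gaussianReal 0 s) L = Complex.exp (-(s * (L 1) ^ 2 : ℝ) / 2) := by
  obtain ⟨c, hc⟩ : ∃ c : ℝ, ∀ x : ℝ, L x = c * x := ⟨L 1, fun x => by
    conv_lhs => rw [← mul_one x, ← smul_eq_mul, map_smul, smul_eq_mul, mul_comm]⟩
  have h2 := charFun_gaussianReal (μ := 0) (v := s) c
  rw [charFun_apply_real] at h2
  rw [charFunDual_apply]
  simp_rw [hc]
  push_cast
  rw [h2]
  simp [neg_div]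

/-- The map (z, w) ↦ (residual, y) is linear and, once w and y are scaled to unit variance,
orthogonal. Hence the residual stays standard Gaussian and is independent of the observation. -/
lemma map_residual_prod {σ : ℝ} (hσ : 0 < σ) (v : E) :
    ((stdGaussian E).prod (gaussianReal 0 (σ ^ 2).toNNReal)).map
        (fun p : E × ℝ => (residual σ v (⟪v, p.1⟫ + p.2) p.1, ⟪v, p.1⟫ + p.2))
      = (stdGaussian E).prod (gaussianReal 0 (σ ^ 2 + ‖v‖ ^ 2).toNNReal) := by
  have hs := predSD_pos hσ v
  have hn : ‖v‖ ^ 2 = predSD σ v ^ 2 - σ ^ 2 := by rw [predSD_sq]; ring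
  let A : E × ℝ →L[ℝ] ℝ := (innerSL ℝ v).comp (ContinuousLinearMap.fst ℝ E ℝ)
  let Y : E × ℝ →L[ℝ] ℝ := A + ContinuousLinearMap.snd ℝ E ℝ
  let Z : E × ℝ →L[ℝ] E := ContinuousLinearMap.fst ℝ E ℝ -
    (shrink σ v • A + (predSD σ v * σ)⁻¹ • ContinuousLinearMap.snd ℝ E ℝ).smulRight v
  have hF : (fun p : E × ℝ => (residual σ v (⟪v, p.1⟫ + p.2) p.1, ⟪v, p.1⟫ + p.2))
      = ⇑(Z.prod Y) := by
    ext p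
    · simp [Z, A, residual, div_eq_inv_mul]
    · simp [Y, A]
  rw [hF]
  apply Measure.ext_of_charFunDual
  ext L
  rw [charFunDual_map, charFunDual_prod, charFunDual_prod, charFunDual_stdGaussian,
    charFunDual_stdGaussian, charFunDual_gaussianReal_zero, charFunDual_gaussianReal_zero,
    ← Complex.exp_add, ← Complex.exp_add]
  set u : E := (InnerProductSpace.toDual ℝ E).symm (L.comp (ContinuousLinearMap.inl ℝ E ℝ)) with hu
  have hLu : ∀ x, L (x, 0) = ⟪u, x⟫ := fun x => by
    rw [hu, InnerProductSpace.toDual_symm_apply]; rfl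
  set τ : ℝ := L (0, 1) with hτ
  have hL : ∀ x y, L (x, y) = ⟪u, x⟫ + y * τ := fun x y => by
    rw [← hLu, hτ, ← smul_eq_mul, ← map_smul, ← map_add]; simp
  have h1 : L.comp (ContinuousLinearMap.inl ℝ E ℝ) = innerSL ℝ u := by
    ext x; simp [hLu]
  have h2 : (L.comp (Z.prod Y)).comp (ContinuousLinearMap.inl ℝ E ℝ)
      = innerSL ℝ (u + (τ - ⟪u, v⟫ * shrink σ v) • v) := by
    ext x
    simp only [ContinuousLinearMap.comp_apply, ContinuousLinearMap.prod_apply, hL,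
      innerSL_apply_apply, inner_add_left, inner_smul_left]
    simp [Z, Y, A, inner_sub_right, inner_smul_right]
    ring
  have h3 : ((L.comp (Z.prod Y)).comp (ContinuousLinearMap.inr ℝ E ℝ)) 1
      = τ - ⟪u, v⟫ / (predSD σ v * σ) := by
    simp only [ContinuousLinearMap.comp_apply, ContinuousLinearMap.prod_apply, hL]
    simp [Z, Y, A, inner_smul_right]
    ring
  have h4 : (L.comp (ContinuousLinearMap.inr ℝ E ℝ)) 1 = τ := by simp [hτ]
  rw [h1, h2, h3, h4, innerSL_apply_norm, innerSL_apply_norm]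
  congr 1
  -- Equality of the covariance quadratic forms, which are the exponents of the two characteristic
  -- functions.
  have key : ‖u + (τ - ⟪u, v⟫ * shrink σ v) • v‖ ^ 2
      + σ ^ 2 * (τ - ⟪u, v⟫ / (predSD σ v * σ)) ^ 2
      = ‖u‖ ^ 2 + (σ ^ 2 + ‖v‖ ^ 2) * τ ^ 2 := by
    rw [norm_add_sq_real, inner_smul_right, norm_smul, mul_pow, Real.norm_eq_abs, sq_abs, hn,
      shrink]
    field_simp
    ring
  rw [Real.coe_toNNReal _ (by positivity), Real.coe_toNNReal _ (by positivity)]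
  rw [← Complex.ofReal_pow, ← Complex.ofReal_pow]
  push_cast [← key]
  have key' := congrArg (fun x : ℝ => (x : ℂ)) key
  push_cast at key'
  linear_combination (-1 / 2 : ℂ) * key'

end GaussianUpdate

/-! ### Upper tail of the chi-square distribution. -/

section ChiSquare

variable {ι : Type*} [Fintype ι]

lemma integral_exp_mul_sq_gaussianReal {l : ℝ} (hl : l < 1 / 2) :
    ∫ x, Real.exp (l * x ^ 2) ∂(gaussianReal 0 1) = (√(1 - 2 * l))⁻¹ := by
  rw [integral_gaussianReal_eq_integral_smul one_ne_zero]
  have : ∀ x : ℝ, gaussianPDFReal 0 1 x • Real.exp (l * x ^ 2)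
      = (√(2 * Real.pi))⁻¹ * Real.exp (-(1 / 2 - l) * x ^ 2) := fun x => by
    rw [gaussianPDFReal, smul_eq_mul, mul_assoc, ← Real.exp_add]
    congr 2
    · simp
    · simp
      ring
  simp_rw [this]
  rw [integral_const_mul, integral_gaussian, ← Real.sqrt_inv, ← Real.sqrt_mul (by positivity),
    ← Real.sqrt_inv]
  congr 1
  have : 1 / 2 - l ≠ 0 := by linarith
  have : 1 - 2 * l ≠ 0 := by linarith
  have := Real.pi_pos.ne'
  field_simp

lemma mgf_norm_sq_stdGaussian {l : ℝ} (hl : l < 1 / 2) :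
    mgf (fun z => ‖z‖ ^ 2) (stdGaussian (EuclideanSpace ℝ ι)) l
      = (√(1 - 2 * l))⁻¹ ^ Fintype.card ι := by
  rw [mgf, ← map_pi_eq_stdGaussian, integral_map (by fun_prop) (by fun_prop)]
  simp_rw [EuclideanSpace.real_norm_sq_eq, Finset.mul_sum, Real.exp_sum]
  rw [integral_fintype_prod_eq_prod (f := fun _ x => Real.exp (l * x ^ 2))]
  simp [integral_exp_mul_sq_gaussianReal hl]

/-- The Chernoff bound for the upper tail of the chi-square distribution. -/
lemma stdGaussian_norm_sq_ge_le {δ : ℝ} (hδ : 0 ≤ δ) :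
    (stdGaussian (EuclideanSpace ℝ ι)).real {z | Fintype.card ι * (1 + δ) ≤ ‖z‖ ^ 2}
      ≤ Real.exp (-(Fintype.card ι * min δ (δ ^ 2) / 8)) := by
  set d : ℝ := ((Fintype.card ι : ℕ) : ℝ) with hd
  have hd0 : 0 ≤ d := Nat.cast_nonneg (Fintype.card ι)
  -- The exponent per dimension will be 2l² - lδ: this l gives -δ²/8 when δ ≤ 1 and at most -δ/8
  -- when δ ≥ 1.
  set l : ℝ := min δ 1 / 4 with hl
  have hl0 : 0 ≤ l := by positivity
  have hl1 : l ≤ 1 / 4 := by have := min_le_right δ 1; linarith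
  have hmgf := mgf_norm_sq_stdGaussian (ι := ι) (show l < 1 / 2 by linarith)
  have hpos : 0 < 1 - 2 * l := by linarith
  have hint : Integrable (fun z => Real.exp (l * ‖z‖ ^ 2)) (stdGaussian (EuclideanSpace ℝ ι)) := by
    -- A nonintegrable function has integral 0 by convention, so the positive value of the mgf
    -- forces integrability.
    refine Integrable.of_integral_ne_zero ?_
    rw [mgf] at hmgf
    rw [hmgf]
    positivity
  refine (measure_ge_le_exp_mul_mgf _ hl0 hint).trans ?_
  have h1 : (√(1 - 2 * l))⁻¹ ≤ Real.exp (l + 2 * l ^ 2) := by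
    rw [← Real.sqrt_inv, Real.sqrt_le_left (by positivity), ← Real.exp_nat_mul]
    rw [inv_le_comm₀ hpos (Real.exp_pos _), ← Real.exp_neg]
    rw [Real.exp_neg, inv_le_comm₀ (Real.exp_pos _) hpos]
    have h := Real.quadratic_le_exp_of_nonneg
      (show 0 ≤ ((2 : ℕ) : ℝ) * (l + 2 * l ^ 2) by positivity)
    refine le_trans ?_ h
    rw [inv_le_iff_one_le_mul₀ hpos]
    push_cast
    -- With s = 2l and u = s + s², (1 - s)(1 + u + u²/2) - 1 = (s²/2)(1 - s - s² - s³).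
    have h1 : 0 ≤ 1 - 2 * l - (2 * l) ^ 2 - (2 * l) ^ 3 := by nlinarith
    have h2 := mul_nonneg (sq_nonneg l) h1
    nlinarith
  rw [hmgf]
  calc Real.exp (-l * (d * (1 + δ))) * (√(1 - 2 * l))⁻¹ ^ Fintype.card ι
      ≤ Real.exp (-l * (d * (1 + δ))) * Real.exp (l + 2 * l ^ 2) ^ Fintype.card ι := by gcongr
    _ = Real.exp (d * (2 * l ^ 2 - l * δ)) := by
      rw [← Real.exp_nat_mul, ← Real.exp_add]
      congr 1
      ring
    _ ≤ _ := by
      rw [Real.exp_le_exp, neg_eq_neg_one_mul, mul_div_assoc, mul_left_comm]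
      refine mul_le_mul_of_nonneg_left ?_ hd0
      rcases le_total δ 1 with h | h
      · rw [hl, min_eq_left h]
        have := min_le_right δ (δ ^ 2)
        nlinarith
      · rw [hl, min_eq_right h]
        have := min_le_left δ (δ ^ 2)
        nlinarith

end ChiSquare

/-! ### Independence, conditional sampling and disintegration. -/

section Independence

variable {Ω 𝓧 𝓨 𝓩 𝓣 : Type*} [MeasurableSpace Ω] [MeasurableSpace 𝓧] [MeasurableSpace 𝓨]
  [MeasurableSpace 𝓩] [MeasurableSpace 𝓣] {P : Measure Ω} [IsProbabilityMeasure P]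

lemma hasCondDistrib_of_prodMkRight {X : Ω → 𝓧} {T : Ω → 𝓣} {Y : Ω → 𝓨}
    {κ : Kernel 𝓧 𝓨} [IsMarkovKernel κ]
    (h : HasCondDistrib Y (fun ω => (X ω, T ω)) (κ.prodMkRight 𝓣) P) :
    HasCondDistrib Y X κ P :=
  HasCondDistrib.comp_right (f := Prod.fst) (hf := measurable_fst) (Z := fun ω => (X ω, T ω)) h

/-- If `Y` is drawn from a kernel evaluated at `X`, conditionally independently of `T`, then every
function of `(X, T)` that is independent of `X` is also independent of `(X, Y)`. -/
lemma indepFun_prodMk_of_hasCondDistrib {X : Ω → 𝓧} {T : Ω → 𝓣} {Y : Ω → 𝓨}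
    {κ : Kernel 𝓧 𝓨} [IsMarkovKernel κ]
    (h : HasCondDistrib Y (fun ω => (X ω, T ω)) (κ.prodMkRight 𝓣) P)
    {f : 𝓧 × 𝓣 → 𝓩} (hf : Measurable f) (hind : IndepFun X (fun ω => f (X ω, T ω)) P) :
    IndepFun (fun ω => (X ω, Y ω)) (fun ω => f (X ω, T ω)) P := by
  have hX : AEMeasurable X P := h.aemeasurable_fst.fst
  have hZ : AEMeasurable (fun ω => f (X ω, T ω)) P := hf.comp_aemeasurable h.aemeasurable_fst
  have hY : AEMeasurable Y P := h.aemeasurable_snd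
  have hXY := hasCondDistrib_of_prodMkRight h
  have hg : Measurable fun p : 𝓧 × 𝓣 => (p.1, f p) := measurable_fst.prodMk hf
  have hXZY : HasCondDistrib Y (fun ω => (X ω, f (X ω, T ω))) (κ.prodMkRight 𝓩) P :=
    HasCondDistrib.comp_right (f := fun p : 𝓧 × 𝓣 => (p.1, f p)) (hf := hg)
      (Z := fun ω => (X ω, T ω)) h
  have := Measure.isProbabilityMeasure_map (μ := P) hX
  have := Measure.isProbabilityMeasure_map (μ := P) hZ
  rw [indepFun_iff_map_prod_eq_prod_map_map (by fun_prop) (by fun_prop), hXY.map_eq]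
  have h1 : P.map (fun ω => ((X ω, Y ω), f (X ω, T ω)))
      = ((P.map fun ω => ((X ω, f (X ω, T ω)), Y ω))).map (fun p => ((p.1.1, p.2), p.1.2)) := by
    rw [AEMeasurable.map_map_of_aemeasurable (by fun_prop) (by fun_prop)]
    rfl
  rw [h1, hXZY.map_eq, (indepFun_iff_map_prod_eq_prod_map_map hX hZ).1 hind]
  refine Measure.ext_of_lintegral _ fun g hg => ?_
  rw [lintegral_map hg (by fun_prop), Measure.lintegral_compProd (by fun_prop),
    lintegral_prod _ (Measurable.aemeasurable (by fun_prop)), lintegral_prod _ hg.aemeasurable,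
    Measure.lintegral_compProd (by fun_prop)]
  refine lintegral_congr fun x => ?_
  simp only [Kernel.prodMkRight_apply]
  rw [lintegral_lintegral_swap (Measurable.aemeasurable (by fun_prop))]

lemma indepFun_prodMk_right {X : Ω → 𝓧} {Y : Ω → 𝓨} {Z : Ω → 𝓩} (hX : AEMeasurable X P)
    (hY : AEMeasurable Y P) (hZ : AEMeasurable Z P) (hXY : IndepFun X Y P)
    (hXYZ : IndepFun (fun ω => (X ω, Y ω)) Z P) : IndepFun X (fun ω => (Y ω, Z ω)) P := by
  have hYZ : IndepFun Y Z P := hXYZ.comp measurable_snd measurable_id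
  rw [indepFun_iff_map_prod_eq_prod_map_map (by fun_prop) (by fun_prop)] at *
  have h1 : P.map (fun ω => (X ω, (Y ω, Z ω)))
      = (P.map fun ω => ((X ω, Y ω), Z ω)).map MeasurableEquiv.prodAssoc := by
    rw [AEMeasurable.map_map_of_aemeasurable (by fun_prop) (by fun_prop)]
    rfl
  have := Measure.isProbabilityMeasure_map (μ := P) hX
  have := Measure.isProbabilityMeasure_map (μ := P) hY
  have := Measure.isProbabilityMeasure_map (μ := P) hZ
  rw [h1, hXYZ, hXY, hYZ]
  exact Measure.prodAssoc_prod

/-- Disintegration: if for every fixed `x` the variables `F (x, U)` and `G (x, U)` are independent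
and the law `γ` of `F (x, U)` does not depend on `x`, then for `X` independent of `U` the variable
`F (X, U)` has law `γ` and is independent of `(X, G (X, U))`. -/
lemma indepFun_of_forall_map_eq_prod {U : Ω → 𝓣} {X : Ω → 𝓧} (hX : AEMeasurable X P)
    (hU : AEMeasurable U P) (hind : IndepFun X U P) {F : 𝓧 × 𝓣 → 𝓩} {G : 𝓧 × 𝓣 → 𝓨}
    (hF : Measurable F) (hG : Measurable G) {γ : Measure 𝓩} [IsProbabilityMeasure γ]
    {ν : 𝓧 → Measure 𝓨} [∀ x, IsProbabilityMeasure (ν x)]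
    (h : ∀ x, (P.map U).map (fun u => (F (x, u), G (x, u))) = γ.prod (ν x)) :
    IndepFun (fun ω => (X ω, G (X ω, U ω))) (fun ω => F (X ω, U ω)) P ∧
      P.map (fun ω => F (X ω, U ω)) = γ := by
  have := Measure.isProbabilityMeasure_map (μ := P) hX
  have := Measure.isProbabilityMeasure_map (μ := P) hU
  have hXU : P.map (fun ω => (X ω, U ω)) = (P.map X).prod (P.map U) :=
    (indepFun_iff_map_prod_eq_prod_map_map hX hU).1 hind
  have hXUm : AEMeasurable (fun ω => (X ω, U ω)) P := hX.prodMk hU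
  have hGm : AEMeasurable (fun ω => (X ω, G (X ω, U ω))) P := hX.prodMk (hG.comp_aemeasurable hXUm)
  have hFm : AEMeasurable (fun ω => F (X ω, U ω)) P := hF.comp_aemeasurable hXUm
  -- Tonelli with x held fixed in the inner integrals, so `ν` need not depend measurably on x.
  have hint : ∀ k : 𝓧 × 𝓨 × 𝓩 → ENNReal, Measurable k →
      ∫⁻ ω, k (X ω, G (X ω, U ω), F (X ω, U ω)) ∂P
        = ∫⁻ x, ∫⁻ y, ∫⁻ z, k (x, y, z) ∂γ ∂(ν x) ∂(P.map X) := by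
    intro k hk
    have e1 : ∫⁻ ω, k (X ω, G (X ω, U ω), F (X ω, U ω)) ∂P
        = ∫⁻ p, k (p.1, G p, F p) ∂(P.map fun ω => (X ω, U ω)) := by
      rw [lintegral_map' (Measurable.aemeasurable (by fun_prop)) hXUm]
    rw [e1, hXU, lintegral_prod _ (Measurable.aemeasurable (by fun_prop))]
    refine lintegral_congr fun x => ?_
    have e2 : ∫⁻ u, k (x, G (x, u), F (x, u)) ∂(P.map U)
        = ∫⁻ q, k (x, q.2, q.1) ∂((P.map U).map (fun u => (F (x, u), G (x, u)))) := by
      exact (lintegral_map (f := fun q : 𝓩 × 𝓨 => k (x, q.2, q.1))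
        (g := fun u => (F (x, u), G (x, u))) (by fun_prop) (by fun_prop)).symm
    rw [e2, h x, lintegral_prod_symm _ (Measurable.aemeasurable (by fun_prop))]
  have hprod : P.map (fun ω => ((X ω, G (X ω, U ω)), F (X ω, U ω)))
      = (P.map fun ω => (X ω, G (X ω, U ω))).prod γ := by
    refine Measure.ext_of_lintegral _ fun g hg => ?_
    rw [lintegral_map' hg.aemeasurable (hGm.prodMk hFm), lintegral_prod _ hg.aemeasurable,
      lintegral_map' (Measurable.aemeasurable (by fun_prop)) hGm,
      hint (fun p => g ((p.1, p.2.1), p.2.2)) (by fun_prop),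
      hint (fun p => ∫⁻ z, g ((p.1, p.2.1), z) ∂γ) (by fun_prop)]
    simp
  have hmap : P.map (fun ω => F (X ω, U ω)) = γ := by
    have := congrArg Measure.snd hprod
    have hp := Measure.isProbabilityMeasure_map (μ := P) hGm
    rwa [Measure.snd_map_prodMk₀ hGm, Measure.snd_prod] at this
  refine ⟨?_, hmap⟩
  rw [indepFun_iff_map_prod_eq_prod_map_map hGm hFm, hprod, hmap]

lemma integral_of_indepFun {Q : Ω → 𝓧} {Z : Ω → 𝓩} (hQ : AEMeasurable Q P)
    (hZ : AEMeasurable Z P) (hind : IndepFun Q Z P) {g : 𝓧 × 𝓩 → ℝ} (hg : Measurable g)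
    (hint : Integrable (fun ω => g (Q ω, Z ω)) P) :
    ∫ ω, g (Q ω, Z ω) ∂P = ∫ ω, ∫ z, g (Q ω, z) ∂(P.map Z) ∂P := by
  have := Measure.isProbabilityMeasure_map (μ := P) hQ
  have := Measure.isProbabilityMeasure_map (μ := P) hZ
  have hQZ := (indepFun_iff_map_prod_eq_prod_map_map hQ hZ).1 hind
  have h1 : ∫ ω, g (Q ω, Z ω) ∂P = ∫ p, g p ∂(P.map fun ω => (Q ω, Z ω)) :=
    (integral_map (hQ.prodMk hZ) hg.aestronglyMeasurable).symm
  have h2 : Integrable g (P.map fun ω => (Q ω, Z ω)) :=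
    (integrable_map_measure hg.aestronglyMeasurable (hQ.prodMk hZ)).2 hint
  rw [hQZ] at h1 h2
  rw [h1, integral_prod _ h2, integral_map hQ]
  exact h2.integral_prod_left.aestronglyMeasurable

end Independence

/-! ### Recursive posterior mean and covariance factor. -/

section Recursion

variable {E : Type*} [NormedAddCommGroup E] [InnerProductSpace ℝ E] [FiniteDimensional ℝ E]

/-- Update of a factor `C` of the covariance `C† C` after an observation along `a`. -/
noncomputable def factorStep (σ : ℝ) (C : E →L[ℝ] E) (a : E) : E →L[ℝ] E :=
  C - ((shrink σ (C a) • innerSL ℝ (C a)).comp C).smulRight (C a)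

omit [FiniteDimensional ℝ E] in
lemma factorStep_apply (σ : ℝ) (C : E →L[ℝ] E) (a x : E) :
    factorStep σ C a x = C x - (shrink σ (C a) * ⟪C a, C x⟫) • C a := by
  simp [factorStep]

lemma adjoint_factorStep_apply (σ : ℝ) (C : E →L[ℝ] E) (a z : E) :
    (factorStep σ C a).adjoint z
      = C.adjoint z - (shrink σ (C a) * ⟪C a, z⟫) • C.adjoint (C a) := by
  refine ext_inner_right ℝ fun x => ?_
  rw [ContinuousLinearMap.adjoint_inner_left, factorStep_apply, inner_sub_left, inner_sub_right,
    inner_smul_left, inner_smul_right, ContinuousLinearMap.adjoint_inner_left,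
    ContinuousLinearMap.adjoint_inner_left, real_inner_comm z (C a)]
  simp
  ring

omit [FiniteDimensional ℝ E] in
-- The factor update induces on C† C exactly the rank-one update of `posteriorCov`.
lemma inner_factorStep {σ : ℝ} (hσ : 0 < σ) (C : E →L[ℝ] E) (a x y : E) :
    ⟪factorStep σ C a x, factorStep σ C a y⟫
      = ⟪C x, C y⟫ - (σ ^ 2 + ‖C a‖ ^ 2)⁻¹ * (⟪C a, C x⟫ * ⟪C a, C y⟫) := by
  rw [← two_mul_shrink_sub hσ, factorStep_apply, factorStep_apply]
  simp only [inner_sub_left, inner_sub_right, inner_smul_left, inner_smul_right,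
    real_inner_self_eq_norm_sq, real_inner_comm (C a) (C x)]
  simp
  ring

omit [FiniteDimensional ℝ E] in
lemma norm_factorStep_le {σ : ℝ} (hσ : 0 < σ) (C : E →L[ℝ] E) (a x : E) :
    ‖factorStep σ C a x‖ ≤ ‖C x‖ := by
  refine le_of_sq_le_sq ?_ (norm_nonneg _)
  rw [← real_inner_self_eq_norm_sq, ← real_inner_self_eq_norm_sq, inner_factorStep hσ]
  have : 0 ≤ (σ ^ 2 + ‖C a‖ ^ 2)⁻¹ * (⟪C a, C x⟫ * ⟪C a, C x⟫) :=
    mul_nonneg (by positivity) (mul_self_nonneg _)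
  linarith

variable (σ : ℝ) (C₀ : E →L[ℝ] E)

/-- A factor `C` of the posterior covariance `C† C` given a history, when the prior covariance is
`C₀† C₀`. -/
noncomputable def factor : (t : ℕ) → (Fin t → E × ℝ) → E →L[ℝ] E
  | 0, _ => C₀
  | t + 1, h => factorStep σ (factor t (Fin.init h)) (h (Fin.last t)).1

/-- The posterior mean given a history. -/
noncomputable def center : (t : ℕ) → (Fin t → E × ℝ) → E
  | 0, _ => 0
  | t + 1, h =>
    let C := factor σ C₀ t (Fin.init h)
    let m := center t (Fin.init h)
    let a := (h (Fin.last t)).1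
    m + (((h (Fin.last t)).2 - ⟪m, a⟫) / (σ ^ 2 + ‖C a‖ ^ 2)) • C.adjoint (C a)

/-- The standardized deviation of the parameter `C₀† z` from its posterior mean. -/
noncomputable def standardized : (t : ℕ) → (Fin t → E × ℝ) → E → E
  | 0, _, z => z
  | t + 1, h, z =>
    let a := (h (Fin.last t)).1
    residual σ (factor σ C₀ t (Fin.init h) a)
      ((h (Fin.last t)).2 - ⟪center σ C₀ t (Fin.init h), a⟫) (standardized t (Fin.init h) z)

variable {σ}

/-- A purely algebraic identity, valid for every history whether or not z generated it; the
inductive step is `residual_add_shrink` pushed through the adjoint of the factor. -/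
lemma center_add_adjoint_factor (hσ : 0 < σ) (t : ℕ) (h : Fin t → E × ℝ) (z : E) :
    center σ C₀ t h + (factor σ C₀ t h).adjoint (standardized σ C₀ t h z) = C₀.adjoint z := by
  induction t with
  | zero => simp [center, factor, standardized]
  | succ t ih =>
    rw [← ih (Fin.init h)]
    simp only [center, factor, standardized]
    set C := factor σ C₀ t (Fin.init h)
    set m := center σ C₀ t (Fin.init h)
    set a := (h (Fin.last t)).1
    set y := (h (Fin.last t)).2 - ⟪m, a⟫
    conv_rhs => rw [residual_add_shrink hσ (C a) y (standardized σ C₀ t (Fin.init h) z)]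
    rw [adjoint_factorStep_apply, map_add, map_sub, map_smul, map_smul, add_assoc]

omit [FiniteDimensional ℝ E] in
-- Observations never increase the covariance. This bound, uniform in the history, supplies the
-- integrability needed later.
lemma norm_factor_le (hσ : 0 < σ) (t : ℕ) (h : Fin t → E × ℝ) (x : E) :
    ‖factor σ C₀ t h x‖ ≤ ‖C₀ x‖ := by
  induction t with
  | zero => simp [factor]
  | succ t ih => exact (norm_factorStep_le hσ _ _ _).trans (ih _)

variable (σ) [MeasurableSpace E] [BorelSpace E]

omit [NormedAddCommGroup E] [InnerProductSpace ℝ E] [FiniteDimensional ℝ E] [BorelSpace E] in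
lemma measurable_init (t : ℕ) :
    Measurable (Fin.init : (Fin (t + 1) → E × ℝ) → (Fin t → E × ℝ)) :=
  measurable_pi_iff.2 fun i => measurable_pi_apply i.castSucc

omit [NormedAddCommGroup E] [InnerProductSpace ℝ E] [FiniteDimensional ℝ E] [BorelSpace E] in
lemma measurable_init_fst (t : ℕ) :
    Measurable fun p : (Fin (t + 1) → E × ℝ) × E => (Fin.init p.1 : Fin t → E × ℝ) :=
  (measurable_init t).comp measurable_fst

omit [NormedAddCommGroup E] [InnerProductSpace ℝ E] [FiniteDimensional ℝ E] [BorelSpace E] in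
lemma measurable_last_fst (t : ℕ) :
    Measurable fun p : (Fin (t + 1) → E × ℝ) × E => p.1 (Fin.last t) :=
  (measurable_pi_apply (Fin.last t)).comp measurable_fst

omit [FiniteDimensional ℝ E] [InnerProductSpace ℝ E] in
lemma measurable_shrink : Measurable (shrink σ : E → ℝ) := by
  unfold shrink predSD
  fun_prop

lemma measurable_residual :
    Measurable fun p : E × ℝ × E => residual σ p.1 p.2.1 p.2.2 := by
  have := measurable_shrink (E := E) σ
  unfold residual predSD
  fun_prop

/-- Joint measurability in history and vector avoids any σ-algebra on operators. -/
lemma measurable_factor (t : ℕ) :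
    Measurable fun p : (Fin t → E × ℝ) × E => factor σ C₀ t p.1 p.2 := by
  induction t with
  | zero => simp only [factor]; fun_prop
  | succ t ih =>
    simp only [factor, factorStep_apply]
    have hi := measurable_init_fst (E := E) t
    have h1 := ih.comp (hi.prodMk measurable_snd)
    have h2 := ih.comp (hi.prodMk (measurable_last_fst t).fst)
    exact h1.sub ((((measurable_shrink σ).comp h2).mul (h2.inner h1)).smul h2)

lemma measurable_adjoint_factor (t : ℕ) :
    Measurable fun p : (Fin t → E × ℝ) × E => (factor σ C₀ t p.1).adjoint p.2 := by
  induction t with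
  | zero => simp only [factor]; fun_prop
  | succ t ih =>
    simp only [factor, adjoint_factorStep_apply]
    have hi := measurable_init_fst (E := E) t
    have h1 := ih.comp (hi.prodMk measurable_snd)
    have h2 := (measurable_factor σ C₀ t).comp (hi.prodMk (measurable_last_fst t).fst)
    have h3 := ih.comp (hi.prodMk h2)
    exact h1.sub ((((measurable_shrink σ).comp h2).mul (h2.inner measurable_snd)).smul h3)

lemma measurable_center (t : ℕ) : Measurable (center σ C₀ t) := by
  induction t with
  | zero => simp only [center]; fun_prop
  | succ t ih =>
    simp only [center]
    have hi := measurable_init (E := E) t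
    have hm := ih.comp hi
    have ha := (measurable_pi_apply (X := fun _ : Fin (t + 1) => E × ℝ) (Fin.last t)).fst
    have hy := (measurable_pi_apply (X := fun _ : Fin (t + 1) => E × ℝ) (Fin.last t)).snd
    have hv := (measurable_factor σ C₀ t).comp (hi.prodMk ha)
    have hw := (measurable_adjoint_factor σ C₀ t).comp (hi.prodMk hv)
    exact hm.add (((hy.sub (hm.inner ha)).div ((hv.norm.pow_const 2).const_add _)).smul hw)

lemma measurable_standardized (t : ℕ) :
    Measurable fun p : (Fin t → E × ℝ) × E => standardized σ C₀ t p.1 p.2 := by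
  induction t with
  | zero => simp only [standardized]; fun_prop
  | succ t ih =>
    simp only [standardized]
    have hi := measurable_init_fst (E := E) t
    have hm := (measurable_center σ C₀ t).comp hi
    have hl := measurable_last_fst (E := E) t
    have hv := (measurable_factor σ C₀ t).comp (hi.prodMk hl.fst)
    have hz := ih.comp (hi.prodMk measurable_snd)
    exact (measurable_residual σ).comp
      (hv.prodMk ((hl.snd.sub (hm.inner hl.fst)).prodMk hz))

end Recursion

/-! ### Conjugacy along the run of Thompson sampling. -/

section Posterior

variable {d : ℕ} {Ω : Type*} [MeasurableSpace Ω] {P : Measure Ω} [IsProbabilityMeasure P]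
  {Sigma0 : Matrix (Fin d) (Fin d) ℝ} {σ : ℝ}
  {aopt : EuclideanSpace ℝ (Fin d) → EuclideanSpace ℝ (Fin d)}
  {θ : Ω → EuclideanSpace ℝ (Fin d)} {W : ℕ → Ω → ℝ}
  {θhat : ℕ → Ω → EuclideanSpace ℝ (Fin d)}

/-- The standardized deviation of `θ` from its posterior mean at time `t`. -/
noncomputable def deviation (σ : ℝ)
    (C₀ D₀ : EuclideanSpace ℝ (Fin d) →L[ℝ] EuclideanSpace ℝ (Fin d))
    (aopt : EuclideanSpace ℝ (Fin d) → EuclideanSpace ℝ (Fin d))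
    (θ : Ω → EuclideanSpace ℝ (Fin d)) (W : ℕ → Ω → ℝ)
    (θhat : ℕ → Ω → EuclideanSpace ℝ (Fin d)) (t : ℕ) (ω : Ω) : EuclideanSpace ℝ (Fin d) :=
  standardized σ C₀ t (history aopt θ W θhat t ω) (D₀ (θ ω))

omit [MeasurableSpace Ω] in
lemma center_add_adjoint_factor_deviation (hσ : 0 < σ)
    {C₀ D₀ : EuclideanSpace ℝ (Fin d) →L[ℝ] EuclideanSpace ℝ (Fin d)}
    (hD : ∀ x, C₀.adjoint (D₀ x) = x) (t : ℕ) (ω : Ω) :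
    center σ C₀ t (history aopt θ W θhat t ω)
      + (factor σ C₀ t (history aopt θ W θhat t ω)).adjoint
          (deviation σ C₀ D₀ aopt θ W θhat t ω) = θ ω := by
  rw [deviation, center_add_adjoint_factor C₀ hσ, hD]

omit [MeasurableSpace Ω] in
-- The innovation is a noisy linear observation of the deviation, the situation of
-- `map_residual_prod`.
lemma reward_sub_inner_center (hσ : 0 < σ)
    {C₀ D₀ : EuclideanSpace ℝ (Fin d) →L[ℝ] EuclideanSpace ℝ (Fin d)}
    (hD : ∀ x, C₀.adjoint (D₀ x) = x) (t : ℕ) (ω : Ω) :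
    reward aopt θ W θhat t ω
        - ⟪center σ C₀ t (history aopt θ W θhat t ω), aopt (θhat t ω)⟫
      = ⟪factor σ C₀ t (history aopt θ W θhat t ω) (aopt (θhat t ω)),
          deviation σ C₀ D₀ aopt θ W θhat t ω⟫ + W t ω := by
  have h := center_add_adjoint_factor_deviation (aopt := aopt) (θ := θ) (W := W) (θhat := θhat)
    hσ hD t ω
  generalize deviation σ C₀ D₀ aopt θ W θhat t ω = z at *
  generalize history aopt θ W θhat t ω = h at *
  rw [reward, action, ← h, inner_add_left, ContinuousLinearMap.adjoint_inner_left,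
    real_inner_comm z]
  ring

omit [MeasurableSpace Ω] in
lemma history_succ (t : ℕ) (ω : Ω) :
    history aopt θ W θhat (t + 1) ω
      = (Fin.snoc (history aopt θ W θhat t ω) (aopt (θhat t ω), reward aopt θ W θhat t ω) :
          Fin (t + 1) → EuclideanSpace ℝ (Fin d) × ℝ) :=
  (Fin.snoc_init_self (history aopt θ W θhat (t + 1) ω)).symm

omit [MeasurableSpace Ω] in
lemma deviation_succ
    {C₀ D₀ : EuclideanSpace ℝ (Fin d) →L[ℝ] EuclideanSpace ℝ (Fin d)} (t : ℕ) (ω : Ω) :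
    deviation σ C₀ D₀ aopt θ W θhat (t + 1) ω
      = residual σ (factor σ C₀ t (history aopt θ W θhat t ω) (aopt (θhat t ω)))
          (reward aopt θ W θhat t ω
            - ⟪center σ C₀ t (history aopt θ W θhat t ω), aopt (θhat t ω)⟫)
          (deviation σ C₀ D₀ aopt θ W θhat t ω) :=
  rfl

namespace IsThompsonSampling

variable (hTS : IsThompsonSampling P Sigma0 σ aopt θ W θhat)
include hTS

lemma aemeasurable_history (t : ℕ) : AEMeasurable (history aopt θ W θhat t) P :=
  (hTS.sampling t).aemeasurable_fst.fst

lemma aemeasurable_theta : AEMeasurable θ P := hTS.prior.aemeasurable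

lemma aemeasurable_thetahat (t : ℕ) : AEMeasurable (θhat t) P :=
  (hTS.sampling t).aemeasurable_snd

lemma aemeasurable_noise (t : ℕ) : AEMeasurable (W t) P := (hTS.noise_law t).aemeasurable

/-- Probability matching: the sample has the same joint law with the history as the parameter. -/
lemma map_history_thetahat (t : ℕ) :
    P.map (fun ω => (history aopt θ W θhat t ω, θhat t ω))
      = P.map (fun ω => (history aopt θ W θhat t ω, θ ω)) := by
  rw [(hasCondDistrib_of_prodMkRight (hTS.sampling t)).map_eq,
    compProd_map_condDistrib hTS.aemeasurable_theta]

variable {C₀ D₀ : EuclideanSpace ℝ (Fin d) →L[ℝ] EuclideanSpace ℝ (Fin d)}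

lemma aemeasurable_deviation (t : ℕ) :
    AEMeasurable (deviation σ C₀ D₀ aopt θ W θhat t) P :=
  (measurable_standardized σ C₀ t).comp_aemeasurable
    ((hTS.aemeasurable_history t).prodMk
      (D₀.continuous.measurable.comp_aemeasurable hTS.aemeasurable_theta))

lemma indepFun_history_thetahat_deviation {t : ℕ}
    (h : IndepFun (history aopt θ W θhat t) (deviation σ C₀ D₀ aopt θ W θhat t) P) :
    IndepFun (fun ω => (history aopt θ W θhat t ω, θhat t ω))
      (deviation σ C₀ D₀ aopt θ W θhat t) P :=
  indepFun_prodMk_of_hasCondDistrib (hTS.sampling t)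
    (f := fun p => standardized σ C₀ t p.1 (D₀ p.2))
    ((measurable_standardized σ C₀ t).comp
      (measurable_fst.prodMk (D₀.continuous.measurable.comp measurable_snd))) h

/-- The conjugacy of the Gaussian prior: given the history, the parameter is Gaussian with mean
`center` and covariance `factor† factor`. -/
lemma indepFun_deviation_and_map_deviation (hσ : 0 < σ) (haopt : Measurable aopt)
    (hD : ∀ x, C₀.adjoint (D₀ x) = x)
    (hlaw : P.map (fun ω => D₀ (θ ω)) = stdGaussian (EuclideanSpace ℝ (Fin d))) (t : ℕ) :
    IndepFun (history aopt θ W θhat t) (deviation σ C₀ D₀ aopt θ W θhat t) P ∧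
      P.map (deviation σ C₀ D₀ aopt θ W θhat t) = stdGaussian (EuclideanSpace ℝ (Fin d)) := by
  induction t with
  | zero =>
    refine ⟨?_, hlaw⟩
    have : history aopt θ W θhat 0 = fun _ => Fin.elim0 := by
      funext ω i
      exact i.elim0
    rw [this]
    exact indepFun_const_left _ _
  | succ t ih =>
    obtain ⟨hind, hmap⟩ := ih
    set H := history aopt θ W θhat t with hH
    set Z := deviation σ C₀ D₀ aopt θ W θhat t with hZ
    have hHm : AEMeasurable H P := hTS.aemeasurable_history t
    have hθm := hTS.aemeasurable_theta
    have hθhm := hTS.aemeasurable_thetahat t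
    have hWm := hTS.aemeasurable_noise t
    have hZm : AEMeasurable Z P := hTS.aemeasurable_deviation t
    have hXm : AEMeasurable (fun ω => (H ω, θhat t ω)) P := hHm.prodMk hθhm
    have hXZ : IndepFun (fun ω => (H ω, θhat t ω)) Z P :=
      hTS.indepFun_history_thetahat_deviation hind
    have hXZW : IndepFun (fun ω => ((H ω, θhat t ω), Z ω)) (W t) P := by
      have := (hTS.noise_indep t).symm.comp (φ := fun p => ((p.2.1, p.2.2),
        standardized σ C₀ t p.2.1 (D₀ p.1))) (ψ := id)
        ((measurable_snd.fst.prodMk measurable_snd.snd).prodMk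
          ((measurable_standardized σ C₀ t).comp
            (measurable_snd.fst.prodMk (D₀.continuous.measurable.comp measurable_fst))))
        measurable_id
      exact this
    have hXU := indepFun_prodMk_right hXm hZm hWm hXZ hXZW
    have hZW : IndepFun Z (W t) P := hXZW.comp measurable_snd measurable_id
    have hU : P.map (fun ω => (Z ω, W t ω))
        = (stdGaussian (EuclideanSpace ℝ (Fin d))).prod (gaussianReal 0 (σ ^ 2).toNNReal) := by
      rw [(indepFun_iff_map_prod_eq_prod_map_map hZm hWm).1 hZW, hmap, (hTS.noise_law t).map_eq]
    have hvm : Measurable fun x : (Fin t → EuclideanSpace ℝ (Fin d) × ℝ) ×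
        EuclideanSpace ℝ (Fin d) => factor σ C₀ t x.1 (aopt x.2) :=
      (measurable_factor σ C₀ t).comp (measurable_fst.prodMk (haopt.comp measurable_snd))
    have hGm : Measurable fun p : ((Fin t → EuclideanSpace ℝ (Fin d) × ℝ) ×
        EuclideanSpace ℝ (Fin d)) × EuclideanSpace ℝ (Fin d) × ℝ =>
        ⟪factor σ C₀ t p.1.1 (aopt p.1.2), p.2.1⟫ + p.2.2 :=
      ((hvm.comp measurable_fst).inner measurable_snd.fst).add measurable_snd.snd
    have hFm : Measurable fun p : ((Fin t → EuclideanSpace ℝ (Fin d) × ℝ) ×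
        EuclideanSpace ℝ (Fin d)) × EuclideanSpace ℝ (Fin d) × ℝ =>
        residual σ (factor σ C₀ t p.1.1 (aopt p.1.2))
          (⟪factor σ C₀ t p.1.1 (aopt p.1.2), p.2.1⟫ + p.2.2) p.2.1 :=
      (measurable_residual σ).comp
        ((hvm.comp measurable_fst).prodMk (hGm.prodMk measurable_snd.fst))
    have hfix : ∀ x : (Fin t → EuclideanSpace ℝ (Fin d) × ℝ) × EuclideanSpace ℝ (Fin d),
        (P.map fun ω => (Z ω, W t ω)).map
          (fun u => (residual σ (factor σ C₀ t x.1 (aopt x.2))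
            (⟪factor σ C₀ t x.1 (aopt x.2), u.1⟫ + u.2) u.1,
              ⟪factor σ C₀ t x.1 (aopt x.2), u.1⟫ + u.2))
        = (stdGaussian (EuclideanSpace ℝ (Fin d))).prod
          (gaussianReal 0 (σ ^ 2 + ‖factor σ C₀ t x.1 (aopt x.2)‖ ^ 2).toNNReal) := fun x => by
      rw [hU, map_residual_prod hσ]
    obtain ⟨hind', hmap'⟩ := indepFun_of_forall_map_eq_prod
      (X := fun ω => (H ω, θhat t ω)) (U := fun ω => (Z ω, W t ω))
      (F := fun p => residual σ (factor σ C₀ t p.1.1 (aopt p.1.2))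
          (⟪factor σ C₀ t p.1.1 (aopt p.1.2), p.2.1⟫ + p.2.2) p.2.1)
      (G := fun p => ⟪factor σ C₀ t p.1.1 (aopt p.1.2), p.2.1⟫ + p.2.2)
      (ν := fun x => gaussianReal 0 (σ ^ 2 + ‖factor σ C₀ t x.1 (aopt x.2)‖ ^ 2).toNNReal)
      hXm (hZm.prodMk hWm) hXU hFm hGm hfix
    have hdev : deviation σ C₀ D₀ aopt θ W θhat (t + 1) = fun ω =>
        residual σ (factor σ C₀ t (H ω) (aopt (θhat t ω)))
          (⟪factor σ C₀ t (H ω) (aopt (θhat t ω)), Z ω⟫ + W t ω) (Z ω) := by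
      funext ω
      rw [deviation_succ, reward_sub_inner_center hσ hD]
    -- The new history is a function of the old one, the sample and the innovation, all jointly
    -- independent of the new residual.
    have hhist : history aopt θ W θhat (t + 1) = fun ω =>
        (Fin.snoc (H ω) (aopt (θhat t ω),
          (⟪factor σ C₀ t (H ω) (aopt (θhat t ω)), Z ω⟫ + W t ω)
            + ⟪center σ C₀ t (H ω), aopt (θhat t ω)⟫) :
              Fin (t + 1) → EuclideanSpace ℝ (Fin d) × ℝ) := by
      funext ω
      rw [history_succ, hH, hZ, ← reward_sub_inner_center hσ hD, sub_add_cancel]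
    rw [hdev]
    refine ⟨?_, hmap'⟩
    rw [hhist]
    refine hind'.comp (φ := fun p : ((Fin t → EuclideanSpace ℝ (Fin d) × ℝ) ×
        EuclideanSpace ℝ (Fin d)) × ℝ => (Fin.snoc p.1.1 (aopt p.1.2,
          p.2 + ⟪center σ C₀ t p.1.1, aopt p.1.2⟫) :
            Fin (t + 1) → EuclideanSpace ℝ (Fin d) × ℝ)) (ψ := id) ?_ measurable_id
    have hla : Measurable fun p : ((Fin t → EuclideanSpace ℝ (Fin d) × ℝ) ×
        EuclideanSpace ℝ (Fin d)) × ℝ => aopt p.1.2 := haopt.comp measurable_fst.snd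
    have hlast : Measurable fun p : ((Fin t → EuclideanSpace ℝ (Fin d) × ℝ) ×
        EuclideanSpace ℝ (Fin d)) × ℝ => (aopt p.1.2,
          p.2 + ⟪center σ C₀ t p.1.1, aopt p.1.2⟫) :=
      hla.prodMk (measurable_snd.add
        (((measurable_center σ C₀ t).comp measurable_fst.fst).inner hla))
    refine measurable_pi_iff.2 fun i => ?_
    refine Fin.lastCases ?_ (fun j => ?_) i
    · simpa only [Fin.snoc_last] using hlast
    · simp only [Fin.snoc_castSucc]
      exact (measurable_pi_apply j).comp measurable_fst.fst

end IsThompsonSampling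

end Posterior

/-! ### Moments of inner products with an independent standard Gaussian. -/

section StdGaussianIntegrals

variable {E : Type*} [NormedAddCommGroup E] [InnerProductSpace ℝ E] [FiniteDimensional ℝ E]
  [MeasurableSpace E] [BorelSpace E]

lemma integral_inner_stdGaussian (q : E) : ∫ z, ⟪q, z⟫ ∂(stdGaussian E) = 0 :=
  integral_strongDual_stdGaussian (innerSL ℝ q)

lemma integral_inner_sq_stdGaussian (q : E) : ∫ z, ⟪q, z⟫ ^ 2 ∂(stdGaussian E) = ‖q‖ ^ 2 := by
  have h := variance_dual_stdGaussian (innerSL ℝ q)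
  rw [variance_of_integral_eq_zero (by fun_prop) (integral_strongDual_stdGaussian _),
    innerSL_apply_norm] at h
  exact h

variable {Ω : Type*} [MeasurableSpace Ω] {P : Measure Ω} [IsProbabilityMeasure P]
  {Q Z : Ω → E}

omit [IsProbabilityMeasure P] in
lemma integrable_norm_sq_of_map_eq_stdGaussian (hZ : AEMeasurable Z P)
    (hlaw : P.map Z = stdGaussian E) : Integrable (fun ω => ‖Z ω‖ ^ 2) P := by
  have h : Integrable (fun z : E => ‖z‖ ^ 2) (P.map Z) := by
    rw [hlaw]
    exact (IsGaussian.memLp_two_id (μ := stdGaussian E)).integrable_norm_pow (by norm_num)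
  exact h.comp_aemeasurable hZ

omit [IsProbabilityMeasure P] in
lemma integrable_of_map_eq_stdGaussian (hZ : AEMeasurable Z P)
    (hlaw : P.map Z = stdGaussian E) : Integrable Z P := by
  have h : Integrable (fun z : E => z) (P.map Z) := by
    rw [hlaw]
    exact IsGaussian.integrable_id
  exact h.comp_aemeasurable hZ

omit [IsProbabilityMeasure P] in
lemma integrable_inner_of_norm_le {U A : Ω → E} (hU : Integrable U P) (hA : AEMeasurable A P)
    {r : ℝ} (hr : ∀ ω, ‖A ω‖ ≤ r) : Integrable (fun ω => ⟪U ω, A ω⟫) P := by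
  refine (hU.norm.mul_const r).mono' (hU.aestronglyMeasurable.inner hA.aestronglyMeasurable)
    (Filter.Eventually.of_forall fun ω => ?_)
  exact (norm_inner_le_norm _ _).trans
    (mul_le_mul_of_nonneg_left (hr ω) (norm_nonneg _))

lemma integral_inner_eq_zero (hQ : AEMeasurable Q P) (hZ : AEMeasurable Z P)
    (hind : IndepFun Q Z P) (hlaw : P.map Z = stdGaussian E) {K : ℝ} (hK : ∀ ω, ‖Q ω‖ ≤ K) :
    ∫ ω, ⟪Q ω, Z ω⟫ ∂P = 0 := by
  have hint : Integrable (fun ω => ⟪Q ω, Z ω⟫) P := by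
    simp_rw [real_inner_comm (Z _)]
    exact integrable_inner_of_norm_le (integrable_of_map_eq_stdGaussian hZ hlaw) hQ hK
  rw [integral_of_indepFun hQ hZ hind (g := fun p => ⟪p.1, p.2⟫) (by fun_prop) hint, hlaw]
  simp [integral_inner_stdGaussian]

lemma integral_inner_sq_le (hQ : AEMeasurable Q P) (hZ : AEMeasurable Z P)
    (hind : IndepFun Q Z P) (hlaw : P.map Z = stdGaussian E) {K : ℝ} (hK : ∀ ω, ‖Q ω‖ ≤ K) :
    Integrable (fun ω => ⟪Q ω, Z ω⟫ ^ 2) P ∧ ∫ ω, ⟪Q ω, Z ω⟫ ^ 2 ∂P ≤ K ^ 2 := by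
  have hint : Integrable (fun ω => ⟪Q ω, Z ω⟫ ^ 2) P := by
    refine ((integrable_norm_sq_of_map_eq_stdGaussian hZ hlaw).const_mul (K ^ 2)).mono'
      ((hQ.inner hZ).pow_const 2).aestronglyMeasurable (Filter.Eventually.of_forall fun ω => ?_)
    rw [Real.norm_eq_abs, abs_pow, ← mul_pow]
    gcongr
    exact (abs_real_inner_le_norm _ _).trans (by gcongr; exact hK ω)
  refine ⟨hint, ?_⟩
  rw [integral_of_indepFun hQ hZ hind (g := fun p => ⟪p.1, p.2⟫ ^ 2) (by fun_prop) hint, hlaw]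
  simp only [integral_inner_sq_stdGaussian]
  calc ∫ ω, ‖Q ω‖ ^ 2 ∂P ≤ ∫ _, K ^ 2 ∂P := by
        refine integral_mono_of_nonneg (Filter.Eventually.of_forall fun ω => by positivity)
          (integrable_const _) (Filter.Eventually.of_forall fun ω => ?_)
        have := hK ω
        simp only
        gcongr
    _ = K ^ 2 := by simp

omit [IsProbabilityMeasure P] in
-- Bookkeeping for one round: U is the parameter, M its posterior mean, V the error, A the optimal
-- action, B the played action and N the noise.
lemma integrable_and_integral_inner_sub_eq {U M V A B : Ω → E} {N : Ω → ℝ}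
    (hU : ∀ ω, M ω + V ω = U ω) (hM : Integrable M P) (hV : Integrable V P) (hN : Integrable N P)
    (hA : AEMeasurable A P) (hB : AEMeasurable B P) {r : ℝ} (hAr : ∀ ω, ‖A ω‖ ≤ r)
    (hBr : ∀ ω, ‖B ω‖ ≤ r) (hMAB : ∫ ω, ⟪M ω, B ω⟫ ∂P = ∫ ω, ⟪M ω, A ω⟫ ∂P)
    (hVB : ∫ ω, ⟪V ω, B ω⟫ ∂P = 0) (hN0 : ∫ ω, N ω ∂P = 0) :
    Integrable (fun ω => ⟪U ω, A ω⟫ - (⟪U ω, B ω⟫ + N ω)) P ∧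
      ∫ ω, (⟪U ω, A ω⟫ - (⟪U ω, B ω⟫ + N ω)) ∂P = ∫ ω, ⟪V ω, A ω⟫ ∂P := by
  have i1 := integrable_inner_of_norm_le hM hA hAr
  have i2 := integrable_inner_of_norm_le hM hB hBr
  have i3 := integrable_inner_of_norm_le hV hA hAr
  have i4 := integrable_inner_of_norm_le hV hB hBr
  simp_rw [← hU, inner_add_left]
  have i13 : Integrable (fun ω => ⟪M ω, A ω⟫ + ⟪V ω, A ω⟫) P := i1.add i3
  have i24 : Integrable (fun ω => ⟪M ω, B ω⟫ + ⟪V ω, B ω⟫) P := i2.add i4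
  have i5 : Integrable (fun ω => ⟪M ω, B ω⟫ + ⟪V ω, B ω⟫ + N ω) P := i24.add hN
  refine ⟨i13.sub i5, ?_⟩
  rw [integral_sub i13 i5, integral_add i1 i3, integral_add i24 hN, integral_add i2 i4, hMAB, hVB,
    hN0]
  ring

end StdGaussianIntegrals

/-! ### The expected regret of a single round. -/

section Round

variable {d : ℕ} {Ω : Type*} [MeasurableSpace Ω] {P : Measure Ω} [IsProbabilityMeasure P]
  {Sigma0 : Matrix (Fin d) (Fin d) ℝ} {σ r : ℝ}
  {aopt : EuclideanSpace ℝ (Fin d) → EuclideanSpace ℝ (Fin d)}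
  {θ : Ω → EuclideanSpace ℝ (Fin d)} {W : ℕ → Ω → ℝ}
  {θhat : ℕ → Ω → EuclideanSpace ℝ (Fin d)}
  {C₀ D₀ : EuclideanSpace ℝ (Fin d) →L[ℝ] EuclideanSpace ℝ (Fin d)}

lemma norm_adjoint_factor_le (hσ : 0 < σ) (t : ℕ) (h : Fin t → EuclideanSpace ℝ (Fin d) × ℝ)
    (z : EuclideanSpace ℝ (Fin d)) : ‖(factor σ C₀ t h).adjoint z‖ ≤ ‖C₀‖ * ‖z‖ := by
  refine ((factor σ C₀ t h).adjoint.le_opNorm z).trans ?_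
  gcongr
  rw [LinearIsometryEquiv.norm_map]
  exact (factor σ C₀ t h).opNorm_le_bound (norm_nonneg _) fun x =>
    (norm_factor_le C₀ hσ t h x).trans (C₀.le_opNorm x)

lemma norm_factor_apply_le (hσ : 0 < σ) {a : EuclideanSpace ℝ (Fin d)} (ha : ‖a‖ ≤ r) (t : ℕ)
    (h : Fin t → EuclideanSpace ℝ (Fin d) × ℝ) : ‖factor σ C₀ t h a‖ ≤ ‖C₀‖ * r :=
  (norm_factor_le C₀ hσ t h a).trans
    ((C₀.le_opNorm a).trans (mul_le_mul_of_nonneg_left ha (norm_nonneg _)))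

namespace IsThompsonSampling

variable (hTS : IsThompsonSampling P Sigma0 σ aopt θ W θhat)
include hTS

lemma aemeasurable_factor_apply {X : Ω → EuclideanSpace ℝ (Fin d)} (hX : AEMeasurable X P)
    (t : ℕ) : AEMeasurable (fun ω => factor σ C₀ t (history aopt θ W θhat t ω) (X ω)) P :=
  (measurable_factor σ C₀ t).comp_aemeasurable ((hTS.aemeasurable_history t).prodMk hX)

lemma aemeasurable_adjoint_factor_apply {X : Ω → EuclideanSpace ℝ (Fin d)}
    (hX : AEMeasurable X P) (t : ℕ) :
    AEMeasurable (fun ω => (factor σ C₀ t (history aopt θ W θhat t ω)).adjoint (X ω)) P :=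
  Measurable.comp_aemeasurable (f := fun ω => (history aopt θ W θhat t ω, X ω))
    (g := fun p => (factor σ C₀ t p.1).adjoint p.2)
    (measurable_adjoint_factor σ C₀ t) ((hTS.aemeasurable_history t).prodMk hX)

lemma integral_comp_history_thetahat (t : ℕ)
    {g : (Fin t → EuclideanSpace ℝ (Fin d) × ℝ) × EuclideanSpace ℝ (Fin d) → ℝ}
    (hg : Measurable g) :
    ∫ ω, g (history aopt θ W θhat t ω, θhat t ω) ∂P
      = ∫ ω, g (history aopt θ W θhat t ω, θ ω) ∂P := by
  have hH := hTS.aemeasurable_history t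
  rw [← integral_map (hH.prodMk (hTS.aemeasurable_thetahat t)) hg.aestronglyMeasurable,
    ← integral_map (hH.prodMk hTS.aemeasurable_theta) hg.aestronglyMeasurable,
    hTS.map_history_thetahat]

/-- The expected instantaneous regret is the expected error of the posterior mean in the
direction of the optimal action. -/
lemma integrable_instRegret_and_integral_eq (hσ : 0 < σ) (haopt : Measurable aopt)
    (hr : ∀ x, ‖aopt x‖ ≤ r) (hD : ∀ x, C₀.adjoint (D₀ x) = x)
    (hlaw : P.map (fun ω => D₀ (θ ω)) = stdGaussian (EuclideanSpace ℝ (Fin d))) (t : ℕ) :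
    Integrable (instRegret aopt θ W θhat t) P ∧
      ∫ ω, instRegret aopt θ W θhat t ω ∂P
        = ∫ ω, ⟪factor σ C₀ t (history aopt θ W θhat t ω) (aopt (θ ω)),
            deviation σ C₀ D₀ aopt θ W θhat t ω⟫ ∂P := by
  obtain ⟨hind, hmap⟩ := hTS.indepFun_deviation_and_map_deviation hσ haopt hD hlaw t
  have hind' := hTS.indepFun_history_thetahat_deviation hind
  have hZm : AEMeasurable (deviation σ C₀ D₀ aopt θ W θhat t) P := hTS.aemeasurable_deviation t
  have hAm : AEMeasurable (fun ω => aopt (θ ω)) P := haopt.comp_aemeasurable hTS.aemeasurable_theta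
  have hAhm : AEMeasurable (fun ω => aopt (θhat t ω)) P :=
    haopt.comp_aemeasurable (hTS.aemeasurable_thetahat t)
  have hrepr := center_add_adjoint_factor_deviation (aopt := aopt) (θ := θ) (W := W)
    (θhat := θhat) hσ hD t
  have hVm : AEMeasurable (fun ω => (factor σ C₀ t (history aopt θ W θhat t ω)).adjoint
      (deviation σ C₀ D₀ aopt θ W θhat t ω)) P :=
    hTS.aemeasurable_adjoint_factor_apply hZm t
  have hVint : Integrable (fun ω => (factor σ C₀ t (history aopt θ W θhat t ω)).adjoint
      (deviation σ C₀ D₀ aopt θ W θhat t ω)) P :=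
    ((integrable_of_map_eq_stdGaussian hZm hmap).norm.const_mul ‖C₀‖).mono'
      hVm.aestronglyMeasurable
      (Filter.Eventually.of_forall fun ω => norm_adjoint_factor_le hσ t _ _)
  have hθint : Integrable θ P := by
    have h : Integrable (fun z => z) (P.map θ) := by
      rw [hTS.prior.map_eq]
      exact IsGaussian.integrable_id
    exact h.comp_aemeasurable hTS.aemeasurable_theta
  -- The posterior mean is integrable as the difference of θ and its error.
  have hmint : Integrable (fun ω => center σ C₀ t (history aopt θ W θhat t ω)) P := by
    refine (hθint.sub hVint).congr (Filter.Eventually.of_forall fun ω => ?_)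
    simp only [Pi.sub_apply]
    rw [← hrepr ω, add_sub_cancel_right]
  have hWint : Integrable (W t) P := by
    have h : Integrable (fun z => z) (P.map (W t)) := by
      rw [(hTS.noise_law t).map_eq]
      exact IsGaussian.integrable_id
    exact h.comp_aemeasurable (hTS.aemeasurable_noise t)
  have hW0 : ∫ ω, W t ω ∂P = 0 := by
    have h := integral_map (hTS.aemeasurable_noise t) (f := fun x : ℝ => x)
      aestronglyMeasurable_id
    rw [← h, (hTS.noise_law t).map_eq, integral_id_gaussianReal]
  have hmeq := hTS.integral_comp_history_thetahat t
    (g := fun p => ⟪center σ C₀ t p.1, aopt p.2⟫)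
    (((measurable_center σ C₀ t).comp measurable_fst).inner (haopt.comp measurable_snd))
  have hV0 : ∫ ω, ⟪(factor σ C₀ t (history aopt θ W θhat t ω)).adjoint
      (deviation σ C₀ D₀ aopt θ W θhat t ω), aopt (θhat t ω)⟫ ∂P = 0 := by
    simp_rw [ContinuousLinearMap.adjoint_inner_left, real_inner_comm _ (deviation _ _ _ _ _ _ _ _ _)]
    refine integral_inner_eq_zero (hTS.aemeasurable_factor_apply hAhm t) hZm ?_ hmap
      (fun ω => norm_factor_apply_le hσ (hr _) t _)
    exact hind'.comp (φ := fun p : (Fin t → EuclideanSpace ℝ (Fin d) × ℝ) ×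
        EuclideanSpace ℝ (Fin d) => factor σ C₀ t p.1 (aopt p.2)) (ψ := id)
      ((measurable_factor σ C₀ t).comp (measurable_fst.prodMk (haopt.comp measurable_snd)))
      measurable_id
  have hmain := integrable_and_integral_inner_sub_eq hrepr hmint hVint hWint hAm hAhm
    (fun ω => hr _) (fun ω => hr _) hmeq hV0 hW0
  refine ⟨hmain.1, hmain.2.trans (integral_congr_ae (Filter.Eventually.of_forall fun ω => ?_))⟩
  simp only
  rw [ContinuousLinearMap.adjoint_inner_left, real_inner_comm]

/-- The expected squared error of the posterior mean is at most the trace of the prior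
covariance. -/
lemma integral_norm_adjoint_factor_deviation_sq_le (hσ : 0 < σ) (haopt : Measurable aopt)
    (hD : ∀ x, C₀.adjoint (D₀ x) = x)
    (hlaw : P.map (fun ω => D₀ (θ ω)) = stdGaussian (EuclideanSpace ℝ (Fin d))) (t : ℕ) :
    Integrable (fun ω => ‖(factor σ C₀ t (history aopt θ W θhat t ω)).adjoint
        (deviation σ C₀ D₀ aopt θ W θhat t ω)‖ ^ 2) P ∧
      ∫ ω, ‖(factor σ C₀ t (history aopt θ W θhat t ω)).adjoint
          (deviation σ C₀ D₀ aopt θ W θhat t ω)‖ ^ 2 ∂P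
        ≤ ∑ i, ‖C₀ (EuclideanSpace.basisFun (Fin d) ℝ i)‖ ^ 2 := by
  obtain ⟨hind, hmap⟩ := hTS.indepFun_deviation_and_map_deviation hσ haopt hD hlaw t
  have hZm : AEMeasurable (deviation σ C₀ D₀ aopt θ W θhat t) P := hTS.aemeasurable_deviation t
  set b := EuclideanSpace.basisFun (Fin d) ℝ
  -- Parseval: each coordinate of the error pairs the deviation with a vector that depends only on
  -- the history.
  have hexp : ∀ ω, ‖(factor σ C₀ t (history aopt θ W θhat t ω)).adjoint
      (deviation σ C₀ D₀ aopt θ W θhat t ω)‖ ^ 2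
      = ∑ i, ⟪factor σ C₀ t (history aopt θ W θhat t ω) (b i),
          deviation σ C₀ D₀ aopt θ W θhat t ω⟫ ^ 2 := fun ω => by
    rw [← b.sum_sq_inner_right]
    simp_rw [ContinuousLinearMap.adjoint_inner_right]
  have hcomp : ∀ i, _ := fun i => integral_inner_sq_le
    (Q := fun ω => factor σ C₀ t (history aopt θ W θhat t ω) (b i))
    (hTS.aemeasurable_factor_apply aemeasurable_const t) hZm
    (hind.comp (φ := fun h => factor σ C₀ t h (b i)) (ψ := id)
      ((measurable_factor σ C₀ t).comp (measurable_id.prodMk measurable_const)) measurable_id)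
    hmap (fun ω => norm_factor_le C₀ hσ t _ (b i))
  simp_rw [hexp]
  refine ⟨integrable_finsetSum _ fun i _ => (hcomp i).1, ?_⟩
  rw [integral_finsetSum _ fun i _ => (hcomp i).1]
  exact Finset.sum_le_sum fun i _ => (hcomp i).2

end IsThompsonSampling

/-- With x = 24 log T / d, the choice δ = max(x, √x) ensures min(δ, δ²) ≥ x, so the tail is at most
T⁻³. -/
lemma exp_neg_tail_le {d T : ℕ} (hd : 0 < d) (hT : 0 < T) :
    Real.exp (-(d * min (max (24 * Real.log T / d) √(24 * Real.log T / d))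
      ((max (24 * Real.log T / d) √(24 * Real.log T / d)) ^ 2) / 8)) ≤ ((T : ℝ) ^ 2)⁻¹ := by
  have hd' : (0 : ℝ) < d := by exact_mod_cast hd
  have hT' : (0 : ℝ) < T := by exact_mod_cast hT
  have hlog : 0 ≤ Real.log T := Real.log_natCast_nonneg T
  set x := 24 * Real.log T / d with hx
  have hx0 : 0 ≤ x := by positivity
  have hmin : x ≤ min (max x √x) ((max x √x) ^ 2) := by
    refine le_min (le_max_left _ _) ?_
    calc x = √x ^ 2 := (Real.sq_sqrt hx0).symm
      _ ≤ _ := by gcongr; exact le_max_right _ _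
  have h1 : d * x = 24 * Real.log T := by rw [hx]; field_simp
  rw [← Real.exp_log (show 0 < ((T : ℝ) ^ 2)⁻¹ by positivity), Real.exp_le_exp, Real.log_inv,
    Real.log_pow]
  have h2 : d * x ≤ d * min (max x √x) ((max x √x) ^ 2) := by gcongr
  push_cast
  linarith

/-- Split at ‖Z‖² = d(1 + δ): below it, Cauchy–Schwarz for Q and Z; above it, ⟨Q, Z⟩ ≤ r‖V‖, with
the second moment of V and the rarity of the event. -/
lemma IsThompsonSampling.integral_instRegret_le
    (hTS : IsThompsonSampling P Sigma0 σ aopt θ W θhat) (hd : 0 < d) {T : ℕ} (hT : 0 < T)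
    (hσ : 0 < σ) (haopt : Measurable aopt) (hr0 : 0 ≤ r)
    (hr : ∀ x, ‖aopt x‖ ≤ r) (hD : ∀ x, C₀.adjoint (D₀ x) = x)
    (hlaw : P.map (fun ω => D₀ (θ ω)) = stdGaussian (EuclideanSpace ℝ (Fin d)))
    {τ : ℝ} (hτ : 0 < τ) (hCτ : ∑ i, ‖C₀ (EuclideanSpace.basisFun (Fin d) ℝ i)‖ ^ 2 ≤ τ)
    (t : ℕ) :
    ∫ ω, instRegret aopt θ W θhat t ω ∂P
      ≤ √d * C₁ d T * ∫ ω, ‖factor σ C₀ t (history aopt θ W θhat t ω) (aopt (θhat t ω))‖ ∂P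
        + r * √τ / T := by
  obtain ⟨-, hmap⟩ := hTS.indepFun_deviation_and_map_deviation hσ haopt hD hlaw t
  obtain ⟨hVint, hVle⟩ := hTS.integral_norm_adjoint_factor_deviation_sq_le hσ haopt hD hlaw t
  have hZm : AEMeasurable (deviation σ C₀ D₀ aopt θ W θhat t) P := hTS.aemeasurable_deviation t
  have hAm : AEMeasurable (fun ω => aopt (θ ω)) P := haopt.comp_aemeasurable hTS.aemeasurable_theta
  have hQm := hTS.aemeasurable_factor_apply (C₀ := C₀) hAm t
  have hnorm := hTS.integral_comp_history_thetahat t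
    (g := fun p => ‖factor σ C₀ t p.1 (aopt p.2)‖)
    (((measurable_factor σ C₀ t).comp
      (measurable_fst.prodMk (haopt.comp measurable_snd))).norm)
  rw [(hTS.integrable_instRegret_and_integral_eq hσ haopt hr hD hlaw t).2, hnorm]
  replace hVle := hVle.trans hCτ
  have hadj : ∀ ω, ⟪factor σ C₀ t (history aopt θ W θhat t ω) (aopt (θ ω)),
      deviation σ C₀ D₀ aopt θ W θhat t ω⟫ = ⟪aopt (θ ω),
        (factor σ C₀ t (history aopt θ W θhat t ω)).adjoint
          (deviation σ C₀ D₀ aopt θ W θhat t ω)⟫ := fun ω => by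
    rw [ContinuousLinearMap.adjoint_inner_right]
  set Z := deviation σ C₀ D₀ aopt θ W θhat t
  set V : Ω → EuclideanSpace ℝ (Fin d) := fun ω =>
    (factor σ C₀ t (history aopt θ W θhat t ω)).adjoint (Z ω) with hV
  set Q : Ω → EuclideanSpace ℝ (Fin d) := fun ω =>
    factor σ C₀ t (history aopt θ W θhat t ω) (aopt (θ ω)) with hQ
  have hT' : (0 : ℝ) < T := by exact_mod_cast hT
  set δ := max (24 * Real.log T / d) √(24 * Real.log T / d) with hδ
  have hδ0 : 0 ≤ δ := le_max_of_le_right (Real.sqrt_nonneg _)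
  have hC₁ : √d * C₁ d T = √(d * (1 + δ)) := by
    rw [C₁, ← Real.sqrt_mul (Nat.cast_nonneg d)]
  set B : Set (EuclideanSpace ℝ (Fin d)) := {z | d * (1 + δ) ≤ ‖z‖ ^ 2} with hB
  have hBm : MeasurableSet B := measurableSet_le measurable_const (by fun_prop)
  have hPB : (stdGaussian (EuclideanSpace ℝ (Fin d))).real B ≤ ((T : ℝ) ^ 2)⁻¹ := by
    have h := stdGaussian_norm_sq_ge_le (ι := Fin d) hδ0
    rw [Fintype.card_fin] at h
    exact h.trans (exp_neg_tail_le hd hT)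
  have hIint : Integrable (fun ω => B.indicator (fun _ => (1 : ℝ)) (Z ω)) P := by
    have h : Integrable (B.indicator fun _ => (1 : ℝ)) (P.map Z) := by
      have := Measure.isProbabilityMeasure_map (μ := P) hZm
      exact (integrable_const _).indicator hBm
    exact h.comp_aemeasurable hZm
  have hIle : ∫ ω, B.indicator (fun _ => (1 : ℝ)) (Z ω) ∂P ≤ ((T : ℝ) ^ 2)⁻¹ := by
    rw [← integral_map (φ := Z) (f := B.indicator fun _ => (1 : ℝ)) hZm
      ((measurable_const.indicator hBm).aestronglyMeasurable), hmap, integral_indicator hBm]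
    simpa using hPB
  have hQint : Integrable (fun ω => ‖Q ω‖) P :=
    (integrable_const (‖C₀‖ * r)).mono' hQm.norm.aestronglyMeasurable
      (Filter.Eventually.of_forall fun ω => by
        rw [norm_norm]; exact norm_factor_apply_le hσ (hr _) t _)
  have hsτ : 0 < √τ := Real.sqrt_pos.2 hτ
  -- This weight in Young's inequality balances E‖V‖² ≤ τ against the probability T⁻²: each side
  -- contributes r√τ / (2T).
  set ε : ℝ := (T * √τ)⁻¹ with hε
  have hε0 : 0 < ε := by positivity
  have hpt : ∀ ω, ⟪Q ω, Z ω⟫ ≤ √d * C₁ d T * ‖Q ω‖ + (r * ε / 2 * ‖V ω‖ ^ 2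
      + r / (2 * ε) * B.indicator (fun _ => (1 : ℝ)) (Z ω)) := by
    intro ω
    by_cases hω : Z ω ∈ B
    · rw [Set.indicator_of_mem hω]
      have h1 : ⟪Q ω, Z ω⟫ ≤ r * ‖V ω‖ := by
        rw [hadj]
        exact (real_inner_le_norm _ _).trans (by gcongr; exact hr _)
      have h2 : ‖V ω‖ ≤ ε / 2 * ‖V ω‖ ^ 2 + 1 / (2 * ε) := by
        have := sq_nonneg (ε * ‖V ω‖ - 1)
        have h3 : ε / 2 * ‖V ω‖ ^ 2 + 1 / (2 * ε) - ‖V ω‖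
            = (ε * ‖V ω‖ - 1) ^ 2 / (2 * ε) := by
          field_simp
          ring
        have : 0 ≤ (ε * ‖V ω‖ - 1) ^ 2 / (2 * ε) := by positivity
        linarith
      have h3 : 0 ≤ √d * C₁ d T * ‖Q ω‖ := by rw [hC₁]; positivity
      calc ⟪Q ω, Z ω⟫ ≤ r * ‖V ω‖ := h1
        _ ≤ r * (ε / 2 * ‖V ω‖ ^ 2 + 1 / (2 * ε)) := by gcongr
        _ = 0 + (r * ε / 2 * ‖V ω‖ ^ 2 + r / (2 * ε) * 1) := by ring
        _ ≤ _ := by gcongr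
    · rw [Set.indicator_of_notMem hω]
      have h1 : ‖Z ω‖ ≤ √(d * (1 + δ)) := by
        apply Real.le_sqrt_of_sq_le
        exact (not_le.1 hω).le
      have h2 : 0 ≤ r * ε / 2 * ‖V ω‖ ^ 2 := by positivity
      calc ⟪Q ω, Z ω⟫ ≤ ‖Q ω‖ * ‖Z ω‖ := real_inner_le_norm _ _
        _ ≤ ‖Q ω‖ * √(d * (1 + δ)) := by gcongr
        _ = √d * C₁ d T * ‖Q ω‖ := by rw [hC₁, mul_comm]
        _ ≤ _ := by linarith
  have f1 : Integrable (fun ω => √d * C₁ d T * ‖Q ω‖) P := hQint.const_mul _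
  have f2 : Integrable (fun ω => r * ε / 2 * ‖V ω‖ ^ 2) P := hVint.const_mul _
  have f3 : Integrable (fun ω => r / (2 * ε) * B.indicator (fun _ => (1 : ℝ)) (Z ω)) P :=
    hIint.const_mul _
  have f23 : Integrable (fun ω => r * ε / 2 * ‖V ω‖ ^ 2
      + r / (2 * ε) * B.indicator (fun _ => (1 : ℝ)) (Z ω)) P := f2.add f3
  have hlhs : Integrable (fun ω => ⟪Q ω, Z ω⟫) P := by
    simp_rw [real_inner_comm (Z _)]
    exact integrable_inner_of_norm_le (integrable_of_map_eq_stdGaussian hZm hmap) hQm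
      (fun ω => norm_factor_apply_le hσ (hr _) t _)
  refine (integral_mono hlhs (f1.add f23) hpt).trans ?_
  rw [integral_add' f1 f23, integral_add f2 f3, integral_const_mul, integral_const_mul,
    integral_const_mul]
  gcongr
  calc r * ε / 2 * ∫ ω, ‖V ω‖ ^ 2 ∂P
        + r / (2 * ε) * ∫ ω, B.indicator (fun _ => (1 : ℝ)) (Z ω) ∂P
      ≤ r * ε / 2 * τ + r / (2 * ε) * ((T : ℝ) ^ 2)⁻¹ := by gcongr
    _ = r * √τ / T := by
      have : τ = √τ ^ 2 := (Real.sq_sqrt hτ.le).symm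
      rw [hε]
      nth_rewrite 2 [this]
      field_simp
      ring

end Round

/-! ### The factor √Σ₀ of the prior and the pathwise potential bound. -/

section PriorFactor

variable {d : ℕ} {Sigma0 : Matrix (Fin d) (Fin d) ℝ}

lemma adjoint_toEuclideanCLM_sqrt (S : Matrix (Fin d) (Fin d) ℝ) :
    (Matrix.toEuclideanCLM (𝕜 := ℝ) (CFC.sqrt S)).adjoint
      = Matrix.toEuclideanCLM (𝕜 := ℝ) (CFC.sqrt S) :=
  IsSelfAdjoint.adjoint_eq ((CFC.sqrt_nonneg S).isSelfAdjoint.map _)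

lemma inner_toEuclideanCLM_sqrt (hS : Sigma0.PosDef) (x y : EuclideanSpace ℝ (Fin d)) :
    ⟪Matrix.toEuclideanCLM (𝕜 := ℝ) (CFC.sqrt Sigma0) x,
        Matrix.toEuclideanCLM (𝕜 := ℝ) (CFC.sqrt Sigma0) y⟫
      = x.ofLp ⬝ᵥ Sigma0.mulVec y.ofLp := by
  rw [← adjoint_toEuclideanCLM_sqrt, ContinuousLinearMap.adjoint_inner_left,
    adjoint_toEuclideanCLM_sqrt, ← mul_apply_eq_comp, ← map_mul,
    CFC.sqrt_mul_sqrt_self _ hS.posSemidef.nonneg, Matrix.inner_toEuclideanCLM]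

lemma isUnit_det_sqrt (hS : Sigma0.PosDef) : IsUnit (CFC.sqrt Sigma0).det := by
  rw [isUnit_iff_ne_zero]
  intro h0
  have h := congrArg Matrix.det (CFC.sqrt_mul_sqrt_self _ hS.posSemidef.nonneg)
  rw [Matrix.det_mul, h0, zero_mul] at h
  exact hS.det_pos.ne h

lemma map_inv_sqrt_multivariateGaussian (hS : Sigma0.PosDef) :
    (multivariateGaussian 0 Sigma0).map
        (Matrix.toEuclideanCLM (𝕜 := ℝ) (CFC.sqrt Sigma0)⁻¹)
      = stdGaussian (EuclideanSpace ℝ (Fin d)) := by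
  rw [multivariateGaussian, Measure.map_map (by fun_prop) (by fun_prop)]
  have : (⇑(Matrix.toEuclideanCLM (𝕜 := ℝ) (CFC.sqrt Sigma0)⁻¹) ∘
      fun x => 0 + Matrix.toEuclideanCLM (𝕜 := ℝ) (CFC.sqrt Sigma0) x) = id := by
    funext x
    rw [Function.comp_apply, zero_add, ← mul_apply_eq_comp, ← map_mul,
      Matrix.nonsing_inv_mul _ (isUnit_det_sqrt hS), map_one]
    rfl
  rw [this, Measure.map_id]

/-- The elliptical potential bound along a history. -/
lemma sum_norm_factor_history_le {Ω : Type*} (hd : 0 < d) {σ r : ℝ} (hσ : 0 < σ)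
    (hS : Sigma0.PosDef) (hr0 : 0 ≤ r)
    {aopt : EuclideanSpace ℝ (Fin d) → EuclideanSpace ℝ (Fin d)} (hr : ∀ x, ‖aopt x‖ ≤ r)
    {θ : Ω → EuclideanSpace ℝ (Fin d)} {W : ℕ → Ω → ℝ}
    {θhat : ℕ → Ω → EuclideanSpace ℝ (Fin d)} (ω : Ω) (T : ℕ) :
    ∑ t ∈ Finset.range T, ‖factor σ (Matrix.toEuclideanCLM (𝕜 := ℝ) (CFC.sqrt Sigma0)) t
        (history aopt θ W θhat t ω) (aopt (θhat t ω))‖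
      ≤ σ * √T * √(d * (2 * Real.log
          (1 + r ^ 2 * ‖Matrix.toEuclideanCLM (𝕜 := ℝ) Sigma0‖ * T / (d * σ ^ 2))))
        + 3 * r * (CFC.sqrt Sigma0).trace := by
  set C₀ := Matrix.toEuclideanCLM (𝕜 := ℝ) (CFC.sqrt Sigma0) with hC₀
  let a : ℕ → Fin d → ℝ := fun t => (aopt (θhat t ω)).ofLp
  let S : ℕ → Matrix (Fin d) (Fin d) ℝ := fun t =>
    Nat.rec Sigma0 (fun t S => posteriorCov σ S (a t)) t
  have hS0 : S 0 = Sigma0 := rfl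
  have hSsucc : ∀ t, S (t + 1) = posteriorCov σ (S t) (a t) := fun t => rfl
  have hpd : (S 0).PosDef := hS
  -- Along the path of ω, the factor satisfies C_t† C_t = S_t.
  have hinner : ∀ t (x y : EuclideanSpace ℝ (Fin d)),
      ⟪factor σ C₀ t (history aopt θ W θhat t ω) x,
        factor σ C₀ t (history aopt θ W θhat t ω) y⟫ = x.ofLp ⬝ᵥ (S t).mulVec y.ofLp := by
    intro t
    induction t with
    | zero => exact inner_toEuclideanCLM_sqrt hS
    | succ t ih =>
      intro x y
      have hstep : factor σ C₀ (t + 1) (history aopt θ W θhat (t + 1) ω)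
          = factorStep σ (factor σ C₀ t (history aopt θ W θhat t ω)) (aopt (θhat t ω)) := rfl
      have hherm := (posDef_posteriorCov_seq hσ hpd hSsucc t).isHermitian
      rw [hstep, inner_factorStep hσ, ← real_inner_self_eq_norm_sq, ih, ih, ih, ih, hSsucc,
        posteriorCov, Matrix.sub_mulVec, Matrix.smul_mulVec, Matrix.vecMulVec_mulVec,
        dotProduct_sub, dotProduct_smul, dotProduct_smul,
        ← mulVec_dotProduct_of_isHermitian hherm (aopt (θhat t ω)).ofLp y.ofLp,
        ← mulVec_dotProduct_of_isHermitian hherm (aopt (θhat t ω)).ofLp x.ofLp,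
        dotProduct_comm x.ofLp ((S t).mulVec (a t))]
      simp only [a, smul_eq_mul, MulOpposite.smul_eq_mul_unop, MulOpposite.unop_op]
  have hnorm : ∀ t, ‖factor σ C₀ t (history aopt θ W θhat t ω) (aopt (θhat t ω))‖
      = √(a t ⬝ᵥ (S t).mulVec (a t)) := fun t => by
    rw [← hinner, real_inner_self_eq_norm_sq, Real.sqrt_sq (norm_nonneg _)]
  have ha : ∀ t, a t ⬝ᵥ a t ≤ r ^ 2 := fun t => by
    have h : a t ⬝ᵥ a t = ‖aopt (θhat t ω)‖ ^ 2 := by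
      rw [EuclideanSpace.real_norm_sq_eq]
      simp [a, dotProduct, sq]
    rw [h]
    have := hr (θhat t ω)
    gcongr
  have hB : ∀ t, a t ⬝ᵥ (S 0).mulVec (a t)
      ≤ r ^ 2 * ‖Matrix.toEuclideanCLM (𝕜 := ℝ) Sigma0‖ := fun t => by
    rw [hS0, ← Matrix.inner_toEuclideanCLM]
    have h1 := hr (θhat t ω)
    calc _ ≤ ‖aopt (θhat t ω)‖ * ‖Matrix.toEuclideanCLM (𝕜 := ℝ) Sigma0 (aopt (θhat t ω))‖ :=
          real_inner_le_norm _ _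
      _ ≤ r * (‖Matrix.toEuclideanCLM (𝕜 := ℝ) Sigma0‖ * r) := by
          gcongr
          exact ((Matrix.toEuclideanCLM (𝕜 := ℝ) Sigma0).le_opNorm _).trans (by gcongr)
      _ = _ := by ring
  have : Nonempty (Fin d) := ⟨⟨0, hd⟩⟩
  have h := sum_sqrt_quadForm_posteriorCov_seq_le hσ hpd hSsucc hr0 ha hB T
  rw [Fintype.card_fin] at h
  simp_rw [hnorm]
  exact h

end PriorFactor

end LinearGaussianBandit

/-- The Bayesian regret bound for Thompson sampling in the linear-Gaussian bandit. The expectations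
in the regret exist, and the regret after `T` rounds is at most
`d σ √T C₂ + 3 r √d tr(Σ₀^{1/2}) C₁ + √(2 r² tr Σ₀)`. -/
theorem theorem1 {d : ℕ} (hd : 0 < d) {T : ℕ} (hT : 0 < T)
    {r σ : ℝ} (hσ : 0 < σ)
    {Sigma0 : Matrix (Fin d) (Fin d) ℝ} (hSigma0 : Sigma0.PosDef)
    {𝒜 : Set (EuclideanSpace ℝ (Fin d))} (h𝒜 : 𝒜 ⊆ Metric.closedBall 0 r)
    {aopt : EuclideanSpace ℝ (Fin d) → EuclideanSpace ℝ (Fin d)}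
    (haopt : LinearGaussianBandit.IsOptimalSelection 𝒜 aopt)
    {Ω : Type*} [MeasurableSpace Ω] (P : Measure Ω) [IsProbabilityMeasure P]
    {θ : Ω → EuclideanSpace ℝ (Fin d)} {W : ℕ → Ω → ℝ}
    {θhat : ℕ → Ω → EuclideanSpace ℝ (Fin d)}
    (hTS : LinearGaussianBandit.IsThompsonSampling P Sigma0 σ aopt θ W θhat) :
    (∀ t < T, Integrable (LinearGaussianBandit.instRegret aopt θ W θhat t) P) ∧
    LinearGaussianBandit.regret P aopt θ W θhat T ≤
      d * σ * √(T : ℝ) * LinearGaussianBandit.C₂ d T σ r Sigma0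
        + 3 * r * √(d : ℝ) * (CFC.sqrt Sigma0).trace * LinearGaussianBandit.C₁ d T
        + √(2 * r ^ 2 * Sigma0.trace) := by
  have hd' : (0 : ℝ) < d := by exact_mod_cast hd
  have hT' : (0 : ℝ) < T := by exact_mod_cast hT
  have hr : ∀ x, ‖aopt x‖ ≤ r := fun x => by
    simpa using h𝒜 (haopt.mem x)
  -- The selection puts a point in the ball, so r cannot be negative.
  have hr0 : 0 ≤ r := (norm_nonneg _).trans (hr 0)
  set C₀ := Matrix.toEuclideanCLM (𝕜 := ℝ) (CFC.sqrt Sigma0) with hC₀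
  set D₀ := Matrix.toEuclideanCLM (𝕜 := ℝ) (CFC.sqrt Sigma0)⁻¹ with hD₀
  have hD : ∀ x, C₀.adjoint (D₀ x) = x := fun x => by
    rw [hC₀, LinearGaussianBandit.adjoint_toEuclideanCLM_sqrt, hD₀,
      ← mul_apply_eq_comp, ← map_mul,
      Matrix.mul_nonsing_inv _ (LinearGaussianBandit.isUnit_det_sqrt hSigma0), map_one]
    rfl
  have hlaw : P.map (fun ω => D₀ (θ ω)) = stdGaussian (EuclideanSpace ℝ (Fin d)) := by
    have h := LinearGaussianBandit.map_inv_sqrt_multivariateGaussian hSigma0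
    rw [← hTS.prior.map_eq, AEMeasurable.map_map_of_aemeasurable
      D₀.continuous.measurable.aemeasurable hTS.prior.aemeasurable] at h
    exact h
  have : Nonempty (Fin d) := ⟨⟨0, hd⟩⟩
  have hτ : 0 < Sigma0.trace := hSigma0.trace_pos
  have hCτ : ∑ i, ‖C₀ (EuclideanSpace.basisFun (Fin d) ℝ i)‖ ^ 2 ≤ Sigma0.trace := by
    refine le_of_eq (Finset.sum_congr rfl fun i _ => ?_)
    rw [← real_inner_self_eq_norm_sq, hC₀, LinearGaussianBandit.inner_toEuclideanCLM_sqrt hSigma0]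
    simp
  refine ⟨fun t _ => (hTS.integrable_instRegret_and_integral_eq hσ haopt.measurable hr hD hlaw
    t).1, ?_⟩
  have hround := hTS.integral_instRegret_le hd hT hσ haopt.measurable hr0 hr hD hlaw hτ hCτ
  set L := 2 * Real.log
    (1 + r ^ 2 * ‖Matrix.toEuclideanCLM (𝕜 := ℝ) Sigma0‖ * T / (d * σ ^ 2)) with hL
  have hC₁ : 0 ≤ LinearGaussianBandit.C₁ d T := Real.sqrt_nonneg _
  have hint : ∀ t, Integrable (fun ω => ‖LinearGaussianBandit.factor σ C₀ t
      (LinearGaussianBandit.history aopt θ W θhat t ω) (aopt (θhat t ω))‖) P := fun t => by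
    refine (integrable_const (‖C₀‖ * r)).mono'
      (hTS.aemeasurable_factor_apply (haopt.measurable.comp_aemeasurable
        (hTS.aemeasurable_thetahat t)) t).norm.aestronglyMeasurable
      (Filter.Eventually.of_forall fun ω => ?_)
    rw [norm_norm]
    exact LinearGaussianBandit.norm_factor_apply_le hσ (hr _) t _
  have hsum : ∑ t ∈ Finset.range T, ∫ ω, ‖LinearGaussianBandit.factor σ C₀ t
      (LinearGaussianBandit.history aopt θ W θhat t ω) (aopt (θhat t ω))‖ ∂P
      ≤ σ * √T * √(d * L) + 3 * r * (CFC.sqrt Sigma0).trace := by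
    rw [← integral_finsetSum _ fun t _ => hint t]
    -- The potential bound is deterministic and holds on every path, so it passes to the
    -- expectation.
    refine (integral_mono (integrable_finsetSum _ fun t _ => hint t) (integrable_const _)
      fun ω => LinearGaussianBandit.sum_norm_factor_history_le hd hσ hSigma0 hr0 hr ω T).trans ?_
    simp [hL]
  calc LinearGaussianBandit.regret P aopt θ W θhat T
      ≤ √d * LinearGaussianBandit.C₁ d T
          * (σ * √T * √(d * L) + 3 * r * (CFC.sqrt Sigma0).trace)
        + r * √Sigma0.trace := by
        refine (Finset.sum_le_sum fun t _ => hround t).trans ?_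
        rw [Finset.sum_add_distrib, ← Finset.mul_sum]
        gcongr
        rw [Finset.sum_const, Finset.card_range, nsmul_eq_mul]
        exact le_of_eq (by field_simp)
    _ ≤ √d * LinearGaussianBandit.C₁ d T
          * (σ * √T * √(d * L) + 3 * r * (CFC.sqrt Sigma0).trace)
        + √(2 * r ^ 2 * Sigma0.trace) := by
        gcongr
        -- The argument yields r √(tr Σ₀); the stated term is weaker by a factor √2.
        refine Real.le_sqrt_of_sq_le ?_
        rw [mul_pow, Real.sq_sqrt hτ.le]
        nlinarith [mul_nonneg (sq_nonneg r) hτ.le]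
    _ = _ := by
        have hdd : √(d : ℝ) * √d = d := Real.mul_self_sqrt hd'.le
        rw [LinearGaussianBandit.C₂, Real.sqrt_mul hd'.le]
        linear_combination (LinearGaussianBandit.C₁ d T * σ * √T * √L) * hdd
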